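/- All graphs are finite and simple. For a graph $G$ let $e(G)$ be its number of edges, let $\mathrm{mc}(G)$ be the largest size of a cut of $G$, that is, the maximum over all $A\subseteq V(G)$ of the number of edges of $G$ with exactly one end in $A$, and let $\mathrm{sp}(G)=\mathrm{mc}(G)-e(G)/2$ be its surplus. A graph is $H$-free if it contains no copy of $H$ as a (not necessarily induced) subgraph. Let $\mathrm{sp}(m,H)$ be the smallest value of $\mathrm{sp}(G)$ over all $H$-free graphs $G$ with exactly $m$ edges ($+\infty$ if there is no such graph), and let $\mathrm{ex}(n,B)$ be the maximum number of edges of a $B$-free graph on $n$ vertices ($0$ if there is no such graph). **Theorem.** Let $H$ be a graph that has a vertex whose removal results in a nontrivial bipartite graph $B$ (nontrivial: with at least two vertices) such that $\mathrm{ex}(n,B)=O(n^{3/2})$ as $n\to\infty$. Then $$\mathrm{sp}(m,H)=\Omega\left(m^{4/5}\right),$$ that is, there is a constant $c=c(H)>0$ with $\mathrm{sp}(m,H)\ge c\,m^{4/5}$ for all integers $m\ge 0$. This is tight if $H$ contains a copy of $K_3$ or of $K_{3,3}$: in that case there is also a constant $C=C(H)>0$ with $\mathrm{sp}(m,H)\le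 C\,m^{4/5}$ for all integers $m\ge 0$, so that $\mathrm{sp}(m,H)=\Theta(m^{4/5})$. -/

import Mathlib

open Filter Asymptotics

namespace MaxCutSurplus

/-- The number of edges of `G`. -/
noncomputable def edgeCount {V : Type*} (G : SimpleGraph V) : ℕ :=
  G.edgeSet.ncard

/-- The size of the cut `(A, Aᶜ)`: the number of edges of `G` with one end in `A` and the other
end outside `A`. -/
noncomputable def cutSize {V : Type*} (G : SimpleGraph V) (A : Set V) : ℕ :=
  edgeCount (G.between A Aᶜ)

/-- `mc(G)`: the largest size of a cut of the finite graph `G`. -/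
noncomputable def maxCut {V : Type*} [Fintype V] (G : SimpleGraph V) : ℕ :=
  (Finset.univ : Finset (Finset V)).sup fun A => cutSize G (A : Set V)

/-- The surplus `sp(G) = mc(G) - e(G) / 2`. -/
noncomputable def surplus {V : Type*} [Fintype V] (G : SimpleGraph V) : ℝ :=
  (maxCut G : ℝ) - (edgeCount G : ℝ) / 2

/-- The surpluses of the `H`-free finite graphs with exactly `m` edges (every finite graph is
isomorphic to one on some `Fin n`). -/
def freeSurpluses {W : Type*} (m : ℕ) (H : SimpleGraph W) : Set EReal :=
  {x | ∃ (n : ℕ) (G : SimpleGraph (Fin n)),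
    H.Free G ∧ edgeCount G = m ∧ x = (surplus G : EReal)}

/-- `sp(m, H)`: the smallest surplus of an `H`-free graph with `m` edges. It is `⊤` if there is
no such graph. -/
noncomputable def minSurplus {W : Type*} (m : ℕ) (H : SimpleGraph W) : EReal :=
  sInf (freeSurpluses m H)

end MaxCutSurplus

/-! The surplus of `G` is the maximum over `y ∈ [-1, 1]^V` of `-¼ ∑ A_uv y_u y_v`
(`neg_quadForm_le_surplus`, `surplus_le`), where `A` is the adjacency matrix. Lower bounds come from
test vectors `y`, upper bounds from a bound on how negative the form can be.

Lower bound. Since `H - v` has `O(n^{3/2})` extremal number and neighbourhoods in an `H`-free graph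
are `(H - v)`-free, neighbourhoods span few edges (`LocallySparse`), so there are few triangles.
Vectors `x_v` with negative inner products along edges are rounded by `y_v = sin ⟨g, x_v⟩`, `g`
Gaussian (`sum_le_surplus`); triangles are the only loss. Fix `D` of order `m^{2/5}`. Either `G` is
`D`-degenerate, and correcting each basis vector by the back-neighbourhood gives surplus of order `m
/ √D` (`surplus_of_degenerate`); or some induced subgraph has minimum degree at least `D`, and it
has only `O(m / D)` vertices, so that centred normalised neighbourhood vectors give surplus of order
`D²` (`surplus_of_minDegree`). Both are of order `m^{4/5}`.

Upper bound. For each large prime `p` there is a graph with about `p⁵` edges and surplus `O(p⁴)`.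
For `K₃`, take `p³` lines of `p` points in a triangle-free geometry and put a random complete
bipartite graph on each line. For `K₃,₃`, take the projective norm graph over the field of order
`p²`: about `p³` vertices, degree `p² - 1`, and smallest eigenvalue of order `-p`. Bertrand's
postulate and disjoint unions then reach every `m` (`exists_free_surplus_le`). -/

namespace MaxCutSurplus

/-! ### Cuts as values of the adjacency form -/

open Classical in
/-- The adjacency indicator of `G`, as a real number. -/
noncomputable def adj {V : Type*} (G : SimpleGraph V) (u v : V) : ℝ :=
  if G.Adj u v then 1 else 0

lemma adj_comm {V : Type*} (G : SimpleGraph V) (u v : V) : adj G u v = adj G v u := by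
  classical exact if_congr (G.adj_comm u v) rfl rfl

lemma adj_nonneg {V : Type*} (G : SimpleGraph V) (u v : V) : 0 ≤ adj G u v := by
  unfold adj; split_ifs <;> norm_num

lemma adj_of_adj {V : Type*} {G : SimpleGraph V} {u v : V} (h : G.Adj u v) : adj G u v = 1 := by
  simp [adj, h]

lemma adj_of_not_adj {V : Type*} {G : SimpleGraph V} {u v : V} (h : ¬ G.Adj u v) :
    adj G u v = 0 := by
  simp [adj, h]

/-- The quadratic form of the adjacency matrix of `G`. -/
noncomputable def quadForm {V : Type*} [Fintype V] (G : SimpleGraph V) (y : V → ℝ) : ℝ :=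
  ∑ u, ∑ v, adj G u v * (y u * y v)

lemma edgeCount_eq_card_edgeFinset {V : Type*} (G : SimpleGraph V) [Fintype G.edgeSet] :
    edgeCount G = G.edgeFinset.card := by
  rw [edgeCount, Set.ncard_eq_toFinset_card', SimpleGraph.edgeFinset]

lemma two_mul_edgeCount {V : Type*} [Fintype V] (G : SimpleGraph V) :
    2 * (edgeCount G : ℝ) = ∑ u, ∑ v, adj G u v := by
  classical
  have h := G.sum_degrees_eq_twice_card_edges
  rw [edgeCount_eq_card_edgeFinset]
  have h3 : ((∑ v, G.degree v : ℕ) : ℝ) = 2 * (G.edgeFinset.card : ℝ) := by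
    rw [h]; push_cast; ring
  rw [← h3]
  push_cast
  refine Finset.sum_congr rfl fun u _ => ?_
  simp only [adj]
  rw [Finset.sum_boole, ← SimpleGraph.card_neighborFinset_eq_degree,
    SimpleGraph.neighborFinset_eq_filter]

open Classical in
/-- The `±1` vector of the cut `(A, Aᶜ)`. -/
noncomputable def cutSign {V : Type*} (A : Set V) (v : V) : ℝ := if v ∈ A then 1 else -1

lemma cutSize_sub {V : Type*} [Fintype V] (G : SimpleGraph V) (A : Set V) :
    (cutSize G A : ℝ) - (edgeCount G : ℝ) / 2 = -quadForm G (cutSign A) / 4 := by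
  have h1 := two_mul_edgeCount G
  have h2 := two_mul_edgeCount (G.between A Aᶜ)
  have h3 : ∑ u, ∑ v, adj (G.between A Aᶜ) u v =
      (∑ u, ∑ v, adj G u v - quadForm G (cutSign A)) / 2 := by
    rw [quadForm, ← Finset.sum_sub_distrib, Finset.sum_div]
    refine Finset.sum_congr rfl fun u _ => ?_
    rw [← Finset.sum_sub_distrib, Finset.sum_div]
    refine Finset.sum_congr rfl fun v _ => ?_
    by_cases hu : u ∈ A <;> by_cases hv : v ∈ A <;> by_cases huv : G.Adj u v <;>
      simp [adj, cutSign, SimpleGraph.between_adj, hu, hv, huv]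
  rw [cutSize]
  linarith

lemma neg_quadForm_cutSign_le {V : Type*} [Fintype V] (G : SimpleGraph V) (A : Set V) :
    -quadForm G (cutSign A) / 4 ≤ surplus G := by
  classical
  rw [← cutSize_sub, surplus]
  have : cutSize G A ≤ maxCut G := by
    have := Finset.le_sup (f := fun A : Finset V => cutSize G (A : Set V))
      (Finset.mem_univ A.toFinset)
    simpa [maxCut] using this
  have : (cutSize G A : ℝ) ≤ maxCut G := by exact_mod_cast this
  linarith

lemma surplus_le {V : Type*} [Fintype V] (G : SimpleGraph V) (M : ℝ)
    (h : ∀ y : V → ℝ, (∀ v, y v = 1 ∨ y v = -1) → -quadForm G y / 4 ≤ M) : surplus G ≤ M := by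
  classical
  obtain ⟨A, -, hA⟩ := Finset.exists_mem_eq_sup (Finset.univ : Finset (Finset V))
    Finset.univ_nonempty (fun A => cutSize G (A : Set V))
  rw [surplus, maxCut, hA, cutSize_sub]
  refine h _ fun v => ?_
  unfold cutSign
  split_ifs <;> simp

/-- Without loops there is no square term, so the form is affine in each coordinate; hence
coordinates can be pushed to `±1` one at a time. -/
lemma quadForm_update {V : Type*} [Fintype V] [DecidableEq V] (G : SimpleGraph V) (y : V → ℝ)
    (w : V) (t : ℝ) :
    quadForm G (Function.update y w t) =
      quadForm G (Function.update y w 0) + t * (2 * ∑ v, adj G w v * y v) := by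
  have key : ∀ u v, adj G u v * (Function.update y w t u * Function.update y w t v) =
      adj G u v * (Function.update y w 0 u * Function.update y w 0 v) +
      ((if u = w then t * (adj G w v * y v) else 0) +
        (if v = w then t * (adj G w u * y u) else 0)) := by
    intro u v
    by_cases hu : u = w <;> by_cases hv : v = w
    · subst hu; subst hv; simp [adj]
    · subst hu; simp [hv]; ring
    · subst hv; simp [hu]; rw [adj_comm]; ring
    · simp [hu, hv]
  simp only [quadForm, key, Finset.sum_add_distrib]
  rw [Finset.sum_comm (f := fun u v => if u = w then t * (adj G w v * y v) else 0)]
  simp only [Finset.sum_ite_eq', Finset.mem_univ, if_true, ← Finset.mul_sum]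
  ring

/-- The surplus dominates the fractional surplus. -/
lemma neg_quadForm_le_surplus {V : Type*} [Fintype V] (G : SimpleGraph V) (y : V → ℝ)
    (hy : ∀ v, |y v| ≤ 1) : -quadForm G y / 4 ≤ surplus G := by
  classical
  have key : ∀ s : Finset V, ∃ z : V → ℝ, (∀ v, |z v| ≤ 1) ∧ (∀ v ∈ s, z v = 1 ∨ z v = -1) ∧
      quadForm G z ≤ quadForm G y := by
    intro s
    induction s using Finset.induction_on with
    | empty => exact ⟨y, hy, by simp, le_rfl⟩
    | insert w s hw ih =>
      obtain ⟨z, hz1, hz2, hz3⟩ := ih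
      set b := 2 * ∑ v, adj G w v * z v
      have h0 : quadForm G z = quadForm G (Function.update z w 0) + z w * b := by
        conv_lhs => rw [← Function.update_eq_self w z]
        rw [quadForm_update]
      -- An affine function of `z w` on `[-1, 1]` is smallest at an endpoint, chosen by the sign of
      -- the slope `b`.
      obtain ⟨t, ht, htb⟩ : ∃ t : ℝ, (t = 1 ∨ t = -1) ∧ t * b ≤ z w * b := by
        have := abs_le.1 (hz1 w)
        rcases le_total 0 b with hb | hb
        · exact ⟨-1, Or.inr rfl, by nlinarith⟩
        · exact ⟨1, Or.inl rfl, by nlinarith⟩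
      refine ⟨Function.update z w t, fun v => ?_, fun v hv => ?_, ?_⟩
      · by_cases h : v = w
        · subst h; rcases ht with rfl | rfl <;> simp
        · rw [Function.update_of_ne h]; exact hz1 v
      · by_cases h : v = w
        · subst h; simpa using ht
        · rw [Function.update_of_ne h]
          exact hz2 v (Finset.mem_of_mem_insert_of_ne hv h)
      · rw [quadForm_update]; linarith
  obtain ⟨z, -, hz, hzy⟩ := key Finset.univ
  have hz' : z = cutSign {v | z v = 1} := by
    funext v
    rcases hz v (Finset.mem_univ v) with h | h <;> norm_num [cutSign, h]
  have := neg_quadForm_cutSign_le G {v | z v = 1}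
  rw [← hz'] at this
  linarith

lemma surplus_eq_of_iso {V V' : Type*} [Fintype V] [Fintype V'] {G : SimpleGraph V}
    {G' : SimpleGraph V'} (φ : G ≃g G') : edgeCount G = edgeCount G' ∧ surplus G' ≤ surplus G := by
  have hadj : ∀ u v, adj G' (φ u) (φ v) = adj G u v := fun u v => by
    classical exact if_congr φ.map_adj_iff rfl rfl
  have hsum : ∀ f : V' → V' → ℝ, ∑ u, ∑ v, f u v = ∑ u, ∑ v, f (φ u) (φ v) := fun f => by
    rw [← Equiv.sum_comp φ.toEquiv]
    refine Finset.sum_congr rfl fun u _ => ?_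
    rw [← Equiv.sum_comp φ.toEquiv]
    rfl
  constructor
  · have h1 := two_mul_edgeCount G
    have h2 := two_mul_edgeCount G'
    rw [hsum] at h2
    simp only [hadj] at h2
    have : (edgeCount G : ℝ) = edgeCount G' := by linarith
    exact_mod_cast this
  · refine surplus_le _ _ fun y hy => ?_
    have h := neg_quadForm_le_surplus G (y ∘ φ) fun v => by
      rcases hy (φ v) with h | h <;> simp [h]
    have : quadForm G' y = quadForm G (y ∘ φ) := by
      simp only [quadForm, hsum, hadj, Function.comp]
    rwa [this]

/-- An `H`-free graph on any finite vertex type bounds `sp(m, H)` from above. -/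
lemma minSurplus_le {W V : Type*} [Fintype V] {H : SimpleGraph W} {G : SimpleGraph V}
    (hG : H.Free G) : minSurplus (edgeCount G) H ≤ (surplus G : EReal) := by
  classical
  let e : G ≃g G.overFin rfl := G.overFinIso rfl
  have h := surplus_eq_of_iso e
  refine le_trans (sInf_le ⟨_, G.overFin rfl, ?_, h.1.symm, rfl⟩) (by exact_mod_cast h.2)
  intro hc
  exact hG (hc.trans ⟨e.symm.toCopy⟩)

lemma le_minSurplus {W : Type*} {H : SimpleGraph W} {m : ℕ} {x : ℝ}
    (h : ∀ (n : ℕ) (G : SimpleGraph (Fin n)), H.Free G → edgeCount G = m → x ≤ surplus G) :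
    (x : EReal) ≤ minSurplus m H := by
  refine le_sInf ?_
  rintro _ ⟨n, G, hG, hm, rfl⟩
  exact_mod_cast h n G hG hm

/-! ### Gaussian sine rounding -/

/-- Reduces the Gaussian expectation of a product of sines to the characteristic function at `x ±
y`. -/
lemma sin_inner_mul_sin_inner {E : Type*} [NormedAddCommGroup E] [InnerProductSpace ℝ E]
    (x y g : E) :
    Real.sin (inner ℝ g x) * Real.sin (inner ℝ g y) =
      (Real.cos (inner ℝ g (x - y)) - Real.cos (inner ℝ g (x + y))) / 2 := by
  rw [inner_sub_right, inner_add_right, Real.cos_sub, Real.cos_add]; ring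

section Rounding

open MeasureTheory ProbabilityTheory

variable {E : Type*} [NormedAddCommGroup E] [InnerProductSpace ℝ E] [FiniteDimensional ℝ E]
  [MeasurableSpace E] [BorelSpace E]

lemma integral_cos_inner_stdGaussian (x : E) :
    ∫ g, Real.cos (inner ℝ g x) ∂(stdGaussian E) = Real.exp (-‖x‖ ^ 2 / 2) := by
  have h := charFun_stdGaussian x
  rw [charFun_apply] at h
  have hint : Integrable (fun g : E => Complex.exp ((inner ℝ g x : ℝ) * Complex.I))
      (stdGaussian E) := by
    refine (integrable_const (1 : ℝ)).mono' (by fun_prop) (Eventually.of_forall fun g => ?_)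
    rw [Complex.norm_exp_ofReal_mul_I]
  have h2 := integral_re hint
  have h3 : ∀ g : E, Real.cos (inner ℝ g x) =
      RCLike.re (Complex.exp ((inner ℝ g x : ℝ) * Complex.I)) := fun g => by
    simp [Complex.exp_ofReal_mul_I_re]
  simp only [h3]
  rw [h2, h]
  have : (-(‖x‖ : ℂ) ^ 2 / 2) = ((-‖x‖ ^ 2 / 2 : ℝ) : ℂ) := by push_cast; ring
  rw [this, ← Complex.ofReal_exp]
  simp only [RCLike.re_to_complex, Complex.ofReal_re]

lemma integrable_cos_inner_stdGaussian (x : E) :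
    Integrable (fun g : E => Real.cos (inner ℝ g x)) (stdGaussian E) := by
  refine (integrable_const (1 : ℝ)).mono' (by fun_prop) (Eventually.of_forall fun g => ?_)
  rw [Real.norm_eq_abs]
  exact Real.abs_cos_le_one _

lemma integrable_sin_mul_sin (x y : E) :
    Integrable (fun g : E => Real.sin (inner ℝ g x) * Real.sin (inner ℝ g y)) (stdGaussian E) := by
  simp only [sin_inner_mul_sin_inner]
  exact ((integrable_cos_inner_stdGaussian _).sub (integrable_cos_inner_stdGaussian _)).div_const _

lemma integral_sin_mul_sin (x y : E) :
    ∫ g, Real.sin (inner ℝ g x) * Real.sin (inner ℝ g y) ∂(stdGaussian E) =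
      Real.exp (-((‖x‖ ^ 2 + ‖y‖ ^ 2) / 2)) * Real.sinh (inner ℝ x y) := by
  simp only [sin_inner_mul_sin_inner]
  rw [integral_div, integral_sub (integrable_cos_inner_stdGaussian _)
    (integrable_cos_inner_stdGaussian _), integral_cos_inner_stdGaussian,
    integral_cos_inner_stdGaussian, Real.sinh_eq, ← mul_div_assoc, mul_sub, ← Real.exp_add,
    ← Real.exp_add, norm_sub_sq_real, norm_add_sq_real]
  congr 3 <;> ring

/-- Sine rounding of a vector assignment. -/
lemma rounding_le_surplus {V : Type*} [Fintype V] (G : SimpleGraph V) (x : V → E) :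
    -(∑ u, ∑ v, adj G u v * (Real.exp (-((‖x u‖ ^ 2 + ‖x v‖ ^ 2) / 2)) *
      Real.sinh (inner ℝ (x u) (x v)))) / 4 ≤ surplus G := by
  have hint : ∀ u v, Integrable (fun g : E => adj G u v *
      (Real.sin (inner ℝ g (x u)) * Real.sin (inner ℝ g (x v)))) (stdGaussian E) := fun u v =>
    (integrable_sin_mul_sin _ _).const_mul _
  have h1 : ∫ g, quadForm G (fun v => Real.sin (inner ℝ g (x v))) ∂(stdGaussian E) =
      ∑ u, ∑ v, adj G u v * (Real.exp (-((‖x u‖ ^ 2 + ‖x v‖ ^ 2) / 2)) *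
      Real.sinh (inner ℝ (x u) (x v))) := by
    simp only [quadForm]
    rw [integral_finsetSum _ fun u _ => integrable_finsetSum _ fun v _ => hint u v]
    refine Finset.sum_congr rfl fun u _ => ?_
    rw [integral_finsetSum _ fun v _ => hint u v]
    refine Finset.sum_congr rfl fun v _ => ?_
    rw [integral_const_mul, integral_sin_mul_sin]
  have h2 : Integrable (fun g : E => quadForm G (fun v => Real.sin (inner ℝ g (x v))))
      (stdGaussian E) := by
    simp only [quadForm]
    exact integrable_finsetSum _ fun u _ => integrable_finsetSum _ fun v _ => hint u v
  -- Sines lie in `[-1, 1]`, so the fractional bound applies for every `g` and may be averaged.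
  have h3 : ∫ _g : E, (-4 * surplus G) ∂(stdGaussian E) ≤
      ∫ g, quadForm G (fun v => Real.sin (inner ℝ g (x v))) ∂(stdGaussian E) := by
    refine integral_mono (integrable_const _) h2 fun g => ?_
    have := neg_quadForm_le_surplus G (fun v => Real.sin (inner ℝ g (x v)))
      fun v => Real.abs_sin_le_one _
    simp only
    linarith
  simp only [integral_const, probReal_univ, one_smul] at h3
  rw [h1] at h3
  linarith

/-- Rounding never amplifies a loss and damps a gain by at most `e⁻²`: for `t ≥ 0`, `e⁻ˢ sinh t ≤ (1
- e⁻²ᵗ) / 2 ≤ t`, while for `t ≤ 0`, `sinh t ≤ t` and `e⁻ˢ ≥ e⁻²`. -/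
lemma exp_neg_mul_sinh_le {s t a b : ℝ} (hts : t ≤ s) (hs : s ≤ 2) (ha : 0 ≤ a) (hb : 0 ≤ b)
    (htab : t ≤ a - b) : Real.exp (-s) * Real.sinh t ≤ a - Real.exp (-2) * b := by
  have he : Real.exp (-2) ≤ 1 := Real.exp_le_one_iff.2 (by norm_num)
  have he0 := Real.exp_pos (-2)
  rcases le_total 0 t with ht | ht
  · have h1 : Real.exp (-s) * Real.sinh t ≤ Real.exp (-t) * Real.sinh t :=
      mul_le_mul_of_nonneg_right (Real.exp_le_exp.2 (by linarith)) (Real.sinh_nonneg_iff.2 ht)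
    have h2 : Real.exp (-t) * Real.sinh t = (1 - Real.exp (-(2 * t))) / 2 := by
      rw [Real.sinh_eq, ← mul_div_assoc, mul_sub, ← Real.exp_add, ← Real.exp_add]
      simp only [neg_add_cancel, Real.exp_zero]
      congr 3; ring
    have h3 := Real.add_one_le_exp (-(2 * t))
    nlinarith
  · have h1 : Real.sinh t ≤ t := Real.sinh_le_self_iff.2 ht
    have h2 : Real.exp (-2) ≤ Real.exp (-s) := Real.exp_le_exp.2 (by linarith)
    nlinarith [Real.exp_pos (-s)]

/-- Rounding of short vectors whose inner products along the edges are at most `a - b`. -/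
lemma sum_le_surplus {V : Type*} [Fintype V] (G : SimpleGraph V) (x : V → E)
    (a b : V → V → ℝ) (hx : ∀ v, ‖x v‖ ^ 2 ≤ 2) (ha : ∀ u v, 0 ≤ a u v) (hb : ∀ u v, 0 ≤ b u v)
    (h : ∀ u v, G.Adj u v → inner ℝ (x u) (x v) ≤ a u v - b u v) :
    (Real.exp (-2) * (∑ u, ∑ v, adj G u v * b u v) - ∑ u, ∑ v, adj G u v * a u v) / 4 ≤
      surplus G := by
  refine le_trans ?_ (rounding_le_surplus G x)
  have : ∑ u, ∑ v, adj G u v * (Real.exp (-((‖x u‖ ^ 2 + ‖x v‖ ^ 2) / 2)) *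
      Real.sinh (inner ℝ (x u) (x v))) ≤
      ∑ u, ∑ v, (adj G u v * a u v - Real.exp (-2) * (adj G u v * b u v)) := by
    refine Finset.sum_le_sum fun u _ => Finset.sum_le_sum fun v _ => ?_
    by_cases huv : G.Adj u v
    · rw [adj_of_adj huv]
      have h1 : inner ℝ (x u) (x v) ≤ (‖x u‖ ^ 2 + ‖x v‖ ^ 2) / 2 := by
        have := real_inner_le_norm (x u) (x v)
        nlinarith [sq_nonneg (‖x u‖ - ‖x v‖)]
      have := exp_neg_mul_sinh_le h1 (by linarith [hx u, hx v]) (ha u v) (hb u v) (h u v huv)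
      linarith
    · simp [adj_of_not_adj huv]
  simp only [Finset.sum_sub_distrib, ← Finset.mul_sum] at this
  linarith

end Rounding

/-! ### Surplus of locally sparse graphs: degenerate and dense cases -/

/-- Every set of `s` vertices with a common neighbour spans `O(s ^ (3 / 2))` edges. -/
def LocallySparse {V : Type*} (G : SimpleGraph V) (C : ℝ) : Prop :=
  ∀ v, ∀ T : Finset V, (∀ u ∈ T, G.Adj v u) →
    ∑ u ∈ T, ∑ w ∈ T, adj G u w ≤ C * (T.card * √(T.card : ℝ))

/-- The vectors are `e_v - (ε / √D) 1_{B v}`, with `B v` the neighbours preceding `v`. For `u ∈ B v`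
the cross term contributes `-ε / √D`, and the loss `ε² |B u ∩ B v| / D` counts triangles with last
vertex `v`. -/
lemma surplus_of_degenerate {V : Type*} [Fintype V] {G : SimpleGraph V} {C D ε : ℝ} (hC : 0 ≤ C)
    (hG : LocallySparse G C) (hD : 0 < D) (f : V → ℕ) (hf : Function.Injective f)
    (B : V → Finset V) (hB : ∀ v u, u ∈ B v ↔ G.Adj v u ∧ f u < f v)
    (hBD : ∀ v, ((B v).card : ℝ) ≤ D) (hε0 : 0 ≤ ε) (hε1 : ε ≤ 1) :
    (Real.exp (-2) * ε - ε ^ 2 * C) * (2 * edgeCount G / √D) / 4 ≤ surplus G := by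
  classical
  set s := √D with hs
  have hs0 : 0 < s := Real.sqrt_pos.2 hD
  have hsD : s ^ 2 = D := Real.sq_sqrt hD.le
  have hvB : ∀ v, v ∉ B v := fun v h => lt_irrefl _ ((hB v v).1 h).2
  have hasym : ∀ u v, u ∈ B v → v ∉ B u := fun u v h h' =>
    lt_asymm ((hB v u).1 h).2 ((hB u v).1 h').2
  let x : V → EuclideanSpace ℝ V := fun v => WithLp.toLp 2 fun i =>
    (if i = v then 1 else 0) - (ε / s) * (if i ∈ B v then 1 else 0)
  have hnorm : ∀ v, ‖x v‖ ^ 2 ≤ 2 := by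
    intro v
    rw [EuclideanSpace.real_norm_sq_eq]
    have : ∀ i, (x v i) ^ 2 =
        (if i = v then 1 else 0) + (ε / s) ^ 2 * (if i ∈ B v then 1 else 0) := by
      intro i
      by_cases hi : i = v
      · subst hi; simp [x, hvB]
      · by_cases hi' : i ∈ B v <;> simp [x, hi, hi']
    simp only [this, Finset.sum_add_distrib, ← Finset.mul_sum, Finset.sum_ite_eq',
      Finset.mem_univ, if_true]
    rw [Finset.sum_boole, Finset.filter_univ_mem]
    have h1 : (ε / s) ^ 2 * ((B v).card : ℝ) ≤ (ε / s) ^ 2 * D :=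
      mul_le_mul_of_nonneg_left (hBD v) (sq_nonneg _)
    have h2 : (ε / s) ^ 2 * D = ε ^ 2 := by rw [← hsD]; field_simp
    have h3 : ε ^ 2 ≤ 1 := by nlinarith
    linarith
  have hinner0 : ∀ u v, u ∈ B v → inner ℝ (x u) (x v) =
      ε ^ 2 / D * ((B u ∩ B v).card : ℝ) - ε / s := by
    intro u v huv
    rw [PiLp.inner_apply]
    have : ∀ i, inner ℝ (x u i) (x v i) =
        ε ^ 2 / D * (if i ∈ B u ∩ B v then 1 else 0) - (ε / s) * (if i = u then 1 else 0) := by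
      intro i
      rw [← hsD]
      by_cases hi : i = u
      · subst hi
        have : i ≠ v := fun h => hvB v (h ▸ huv)
        simp [x, hvB, this, huv]
      · by_cases hi' : i = v
        · subst hi'
          simp [x, hi, hasym _ _ huv]
        · by_cases h1 : i ∈ B u <;> by_cases h2 : i ∈ B v <;> simp [x, hi, hi', h1, h2]
          rw [div_pow, sq_abs, sq_abs]
    simp only [this, Finset.sum_sub_distrib, ← Finset.mul_sum, Finset.sum_ite_eq',
      Finset.mem_univ, if_true, mul_one]
    rw [Finset.sum_boole, Finset.filter_univ_mem]
  have hadj : ∀ u v, adj G u v = (if u ∈ B v then 1 else 0) + (if v ∈ B u then 1 else 0) := by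
    intro u v
    by_cases huv : G.Adj u v
    · rw [adj_of_adj huv]
      rcases lt_or_gt_of_ne (fun h => huv.ne (hf h)) with h | h
      · have h1 : u ∈ B v := (hB _ _).2 ⟨huv.symm, h⟩
        simp [h1, hasym _ _ h1]
      · have h1 : v ∈ B u := (hB _ _).2 ⟨huv, h⟩
        simp [h1, hasym _ _ h1]
    · have h1 : u ∉ B v := fun h => huv ((hB _ _).1 h).1.symm
      have h2 : v ∉ B u := fun h => huv ((hB _ _).1 h).1
      simp [adj_of_not_adj huv, h1, h2]
  have hmem : ∀ u v, G.Adj u v → u ∈ B v ∨ v ∈ B u := by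
    intro u v huv
    have h := hadj u v
    rw [adj_of_adj huv] at h
    by_contra hc
    push Not at hc
    simp [hc.1, hc.2] at h
  have hsymsum : ∀ c : V → V → ℝ, (∀ u v, c u v = c v u) →
      ∑ u, ∑ v, adj G u v * c u v = 2 * ∑ v, ∑ u ∈ B v, c u v := by
    intro c hc
    simp only [hadj, add_mul, Finset.sum_add_distrib, ite_mul, one_mul, zero_mul]
    rw [Finset.sum_comm (f := fun u v => if u ∈ B v then c u v else 0)]
    simp only [Finset.sum_ite_mem, Finset.univ_inter]
    rw [two_mul]
    congr 1
    exact Finset.sum_congr rfl fun u _ => Finset.sum_congr rfl fun v _ => hc u v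
  have hm : (edgeCount G : ℝ) = ∑ v, ((B v).card : ℝ) := by
    have h := hsymsum (fun _ _ => 1) fun _ _ => rfl
    simp only [mul_one, ← two_mul_edgeCount, Finset.sum_const, nsmul_eq_mul] at h
    linarith
  have hround := sum_le_surplus G x (fun u v => ε ^ 2 / D * ((B u ∩ B v).card : ℝ))
    (fun _ _ => ε / s) hnorm (fun _ _ => by positivity) (fun _ _ => by positivity) (by
      intro u v huv
      rcases hmem u v huv with h | h
      · exact (hinner0 u v h).le
      · rw [real_inner_comm, Finset.inter_comm]
        exact (hinner0 v u h).le)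
  have htri : ∑ u, ∑ v, adj G u v * (ε ^ 2 / D * ((B u ∩ B v).card : ℝ)) ≤
      2 * (ε ^ 2 / D * (C * s * edgeCount G)) := by
    rw [hsymsum _ fun u v => by rw [Finset.inter_comm]]
    simp only [← Finset.mul_sum]
    rw [hm, Finset.mul_sum]
    refine mul_le_mul_of_nonneg_left ?_ zero_le_two
    simp only [← Finset.mul_sum]
    refine mul_le_mul_of_nonneg_left ?_ (by positivity)
    rw [Finset.mul_sum]
    refine Finset.sum_le_sum fun v _ => ?_
    have h1 := hG v (B v) fun u hu => ((hB _ _).1 hu).1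
    -- Triangles with last vertex `v` are edges inside `B v`, a set with common neighbour `v`.
    have h2 : ∑ u ∈ B v, ((B u ∩ B v).card : ℝ) ≤ ∑ u ∈ B v, ∑ w ∈ B v, adj G u w := by
      refine Finset.sum_le_sum fun u _ => ?_
      have : ((B u ∩ B v).card : ℝ) = ∑ w ∈ B v, if w ∈ B u then 1 else 0 := by
        rw [Finset.sum_boole, Finset.inter_comm, Finset.filter_mem_eq_inter]
      rw [this]
      refine Finset.sum_le_sum fun w _ => ?_
      rw [hadj]
      split_ifs <;> norm_num
    have h3 : √((B v).card : ℝ) ≤ s := Real.sqrt_le_sqrt (hBD v)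
    have h4 : C * (((B v).card : ℝ) * √((B v).card : ℝ)) ≤ C * s * (B v).card := by
      have := mul_le_mul_of_nonneg_left h3 (mul_nonneg hC (Nat.cast_nonneg (B v).card))
      linarith
    linarith
  have hb : ∑ u, ∑ v, adj G u v * (ε / s) = 2 * edgeCount G * (ε / s) := by
    simp only [← Finset.sum_mul, two_mul_edgeCount]
  rw [hb] at hround
  refine le_trans ?_ hround
  have e1 : 2 * (ε ^ 2 / D * (C * s * edgeCount G)) = ε ^ 2 * C * (2 * edgeCount G / s) := by
    rw [← hsD]; field_simp
  rw [e1] at htri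
  have e2 : 2 * edgeCount G * (ε / s) = ε * (2 * edgeCount G / s) := by ring
  rw [e2]
  linarith

/-- The vectors are `(1_{M v} - δ 1_S) / √(d v)` with `δ = D / |S|`. Centring gains `δ` on each edge
inside `S`, hence `δ |S| D = D²` in all; the codegrees again count triangles, and `hDS` makes their
loss at most half the gain. -/
lemma surplus_of_minDegree {V : Type*} [Fintype V] {G : SimpleGraph V} {C D : ℝ} (hC : 0 ≤ C)
    (hG : LocallySparse G C) (hD : 0 < D) (S : Finset V) (hS : S.Nonempty)
    (M : V → Finset V) (hM : ∀ v u, u ∈ M v ↔ u ∈ S ∧ G.Adj v u)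
    (hMD : ∀ v ∈ S, D ≤ ((M v).card : ℝ))
    (hDS : 2 * C * S.card ≤ Real.exp (-2) * (D * √D)) :
    Real.exp (-2) * D ^ 2 / 8 ≤ surplus G := by
  classical
  set N : ℝ := (S.card : ℝ) with hN
  have hN0 : 0 < N := by rw [hN]; exact_mod_cast hS.card_pos
  set d : V → ℝ := fun v => ((M v).card : ℝ) with hd
  have hd0 : ∀ v ∈ S, 0 < d v := fun v hv => hD.trans_le (hMD v hv)
  have hMS : ∀ v, M v ⊆ S := fun v u hu => ((hM v u).1 hu).1
  set δ := D / N with hδ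
  have hδ0 : 0 < δ := div_pos hD hN0
  have hδN : δ * N = D := div_mul_cancel₀ _ hN0.ne'
  let x : V → EuclideanSpace ℝ V := fun v => if v ∈ S then WithLp.toLp 2 (fun i =>
    if i ∈ S then ((if i ∈ M v then 1 else 0) - δ) / √(d v) else 0) else 0
  have hx0 : ∀ v, v ∉ S → x v = 0 := fun v hv => by simp only [x, hv, if_false]
  have hinner : ∀ u ∈ S, ∀ v ∈ S, inner ℝ (x u) (x v) =
      (((M u ∩ M v).card : ℝ) - δ * (d u + d v) + δ * D) / (√(d u) * √(d v)) := by
    intro u hu v hv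
    rw [PiLp.inner_apply, eq_div_iff (mul_ne_zero (Real.sqrt_ne_zero'.2 (hd0 u hu))
      (Real.sqrt_ne_zero'.2 (hd0 v hv))), Finset.sum_mul]
    have : ∀ i, inner ℝ (x u i) (x v i) * (√(d u) * √(d v)) =
        (if i ∈ M u ∩ M v then 1 else 0) - δ * (if i ∈ M u then 1 else 0)
          - δ * (if i ∈ M v then 1 else 0) + δ ^ 2 * (if i ∈ S then 1 else 0) := by
      intro i
      have h1 := Real.sqrt_ne_zero'.2 (hd0 u hu)
      have h2 := Real.sqrt_ne_zero'.2 (hd0 v hv)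
      by_cases hi : i ∈ S
      · have : inner ℝ (x u i) (x v i) * (√(d u) * √(d v)) =
            ((if i ∈ M u then 1 else 0) - δ) * ((if i ∈ M v then 1 else 0) - δ) := by
          simp only [x, hu, hv, hi, if_true, RCLike.inner_apply, conj_trivial]
          field_simp
        rw [this]
        by_cases h1 : i ∈ M u <;> by_cases h2 : i ∈ M v <;> simp [h1, h2, hi] <;> ring
      · have h1 : i ∉ M u := fun h => hi (hMS _ h)
        have h2 : i ∉ M v := fun h => hi (hMS _ h)
        simp [x, hu, hv, hi, h1, h2]
    simp only [this, Finset.sum_sub_distrib, Finset.sum_add_distrib, ← Finset.mul_sum,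
      Finset.sum_boole, Finset.filter_univ_mem]
    rw [← hδN]
    simp only [hd, hN]
    ring
  have hnorm : ∀ v, ‖x v‖ ^ 2 ≤ 2 := by
    intro v
    by_cases hv : v ∈ S
    · rw [← real_inner_self_eq_norm_sq, hinner v hv v hv, Real.mul_self_sqrt (hd0 v hv).le,
        div_le_iff₀ (hd0 v hv), Finset.inter_self]
      have := mul_le_mul_of_nonneg_left (hMD v hv) hδ0.le
      have h2 := mul_pos hδ0 (hd0 v hv)
      have h3 := hd0 v hv
      simp only [hd] at *
      linarith
    · simp [hx0 v hv]
  have hround := sum_le_surplus G x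
    (fun u v => if u ∈ S ∧ v ∈ S then ((M u ∩ M v).card : ℝ) * (1 / d u + 1 / d v) / 2 else 0)
    (fun u v => if u ∈ S ∧ v ∈ S then δ else 0) hnorm
    (fun u v => by simp only [hd]; split_ifs <;> positivity)
    (fun u v => by split_ifs <;> positivity) (by
      intro u v huv
      by_cases h : u ∈ S ∧ v ∈ S
      · obtain ⟨hu, hv⟩ := h
        simp only [hu, hv, and_self, if_true]
        rw [hinner u hu v hv]
        have a1 := Real.sqrt_pos.2 (hd0 u hu)
        have a2 := Real.sqrt_pos.2 (hd0 v hv)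
        have b1 := Real.sq_sqrt (hd0 u hu).le
        have b2 := Real.sq_sqrt (hd0 v hv).le
        have c1 := hMD u hu
        have c2 := hMD v hv
        change D ≤ d u at c1
        change D ≤ d v at c2
        rw [← b1] at c1
        rw [← b2] at c2
        rw [← b1, ← b2]
        simp only [Real.sqrt_sq a1.le, Real.sqrt_sq a2.le]
        generalize √(d u) = p at *
        generalize √(d v) = q at *
        -- With `p² = d u` and `q² = d v`, replacing `1 / (p q)` by the mean of `1 / p²` and `1 /
        -- q²` costs a square, and the centring terms give at least `δ` because `p² + q² - p q ≥ D`.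
        have e : ((M u ∩ M v).card : ℝ) * (1 / p ^ 2 + 1 / q ^ 2) / 2 - δ -
            (((M u ∩ M v).card : ℝ) - δ * (p ^ 2 + q ^ 2) + δ * D) / (p * q) =
            (((M u ∩ M v).card : ℝ) * (1 / p - 1 / q) ^ 2 / 2) +
              δ * ((p ^ 2 + q ^ 2) - p * q - D) / (p * q) := by
          field_simp
          ring
        have e2 : 0 ≤ (p ^ 2 + q ^ 2) - p * q - D := by nlinarith [sq_nonneg (p - q)]
        have e3 : 0 ≤ (((M u ∩ M v).card : ℝ) * (1 / p - 1 / q) ^ 2 / 2) +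
              δ * ((p ^ 2 + q ^ 2) - p * q - D) / (p * q) := by positivity
        linarith
      · simp only [h, if_false, sub_zero]
        rcases not_and_or.1 h with h | h <;> simp [hx0 _ h])
  have hMadj : ∀ u ∈ S, ∀ v ∈ S, adj G u v = if v ∈ M u then 1 else 0 := by
    intro u hu v hv
    by_cases h : G.Adj u v
    · simp [adj_of_adj h, (hM u v).2 ⟨hv, h⟩]
    · have : v ∉ M u := fun h' => h ((hM u v).1 h').2
      simp [adj_of_not_adj h, this]
  have hsum : ∀ c : V → V → ℝ, ∑ u, ∑ v, adj G u v * (if u ∈ S ∧ v ∈ S then c u v else 0) =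
      ∑ u ∈ S, ∑ v ∈ M u, c u v := by
    intro c
    rw [← Finset.sum_subset (Finset.subset_univ S)]
    · refine Finset.sum_congr rfl fun u hu => ?_
      rw [← Finset.sum_subset (Finset.subset_univ S) (fun v _ hv => by simp [hv])]
      rw [← Finset.inter_eq_right.2 (hMS u), ← Finset.sum_ite_mem]
      refine Finset.sum_congr rfl fun v hv => ?_
      rw [hMadj u hu v hv]
      simp [hu, hv]
    · intro u _ hu
      simp [hu]
  have hsum' : ∀ c : V → V → ℝ, ∑ u ∈ S, ∑ v ∈ M u, c u v = ∑ u ∈ S, ∑ v ∈ M u, c v u := by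
    intro c
    rw [← hsum, ← hsum, Finset.sum_comm]
    refine Finset.sum_congr rfl fun u _ => Finset.sum_congr rfl fun v _ => ?_
    rw [adj_comm]
    simp only [and_comm]
  have htri : ∑ u ∈ S, ∑ v ∈ M u, ((M u ∩ M v).card : ℝ) * (1 / d u + 1 / d v) / 2 ≤
      C / √D * ∑ u ∈ S, d u := by
    -- By symmetry each edge can charge its triangles to one endpoint, so that only edges inside `M
    -- u` need counting.
    have e1 : ∑ u ∈ S, ∑ v ∈ M u, ((M u ∩ M v).card : ℝ) * (1 / d u + 1 / d v) / 2 =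
        ∑ u ∈ S, ∑ v ∈ M u, ((M u ∩ M v).card : ℝ) * (1 / d u) := by
      have h1 := hsum' fun u v => ((M u ∩ M v).card : ℝ) * (1 / d u)
      have h2 : ∀ u v, ((M u ∩ M v).card : ℝ) * (1 / d u + 1 / d v) / 2 =
          (((M u ∩ M v).card : ℝ) * (1 / d u)) / 2 + (((M v ∩ M u).card : ℝ) * (1 / d v)) / 2 := by
        intro u v
        rw [Finset.inter_comm (M v)]
        ring
      simp only [h2, Finset.sum_add_distrib, ← Finset.sum_div]
      linarith
    rw [e1, Finset.mul_sum]
    refine Finset.sum_le_sum fun u hu => ?_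
    have h1 := hG u (M u) fun v hv => ((hM _ _).1 hv).2
    have h2 : ∑ v ∈ M u, ((M u ∩ M v).card : ℝ) ≤ ∑ v ∈ M u, ∑ w ∈ M u, adj G v w := by
      refine Finset.sum_le_sum fun v hv => ?_
      have : ((M u ∩ M v).card : ℝ) = ∑ w ∈ M u, if w ∈ M v then 1 else 0 := by
        rw [Finset.sum_boole, Finset.filter_mem_eq_inter]
      rw [this]
      refine Finset.sum_le_sum fun w hw => ?_
      rw [hMadj v (hMS u hv) w (hMS u hw)]
    have hdu := hd0 u hu
    rw [← Finset.sum_mul]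
    calc (∑ v ∈ M u, ((M u ∩ M v).card : ℝ)) * (1 / d u)
        ≤ C * (d u * √(d u)) * (1 / d u) :=
          mul_le_mul_of_nonneg_right (h2.trans h1) (one_div_nonneg.2 hdu.le)
      _ = C * √(d u) := by field_simp
      _ = C / √(d u) * d u := by
          rw [div_mul_eq_mul_div, eq_div_iff (Real.sqrt_ne_zero'.2 hdu), mul_assoc,
            Real.mul_self_sqrt hdu.le]
      _ ≤ C / √D * d u :=
          mul_le_mul_of_nonneg_right (div_le_div_of_nonneg_left hC (Real.sqrt_pos.2 hD)
            (Real.sqrt_le_sqrt (hMD u hu))) hdu.le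
  have hb : ∑ u ∈ S, ∑ v ∈ M u, δ = δ * ∑ u ∈ S, d u := by
    simp only [Finset.sum_const, nsmul_eq_mul, Finset.mul_sum, hd, mul_comm]
  rw [hsum, hsum, hb] at hround
  have hsd : N * D ≤ ∑ u ∈ S, d u := by
    rw [hN, ← nsmul_eq_mul]
    exact Finset.card_nsmul_le_sum _ _ _ hMD
  have hsD := Real.sqrt_pos.2 hD
  have hδC : C / √D ≤ Real.exp (-2) * δ / 2 := by
    rw [hδ, ← mul_div_assoc, div_div, div_le_div_iff₀ hsD (mul_pos hN0 two_pos)]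
    nlinarith
  have h1 : C / √D * ∑ u ∈ S, d u ≤ Real.exp (-2) * δ / 2 * ∑ u ∈ S, d u :=
    mul_le_mul_of_nonneg_right hδC (Finset.sum_nonneg fun u hu => (hd0 u hu).le)
  have h2 : Real.exp (-2) * δ * (N * D) ≤ Real.exp (-2) * δ * ∑ u ∈ S, d u :=
    mul_le_mul_of_nonneg_left hsd (mul_pos (Real.exp_pos _) hδ0).le
  have h3 : Real.exp (-2) * δ * (N * D) = Real.exp (-2) * D ^ 2 := by
    rw [← hδN]; ring
  linarith

/-- Degeneracy ordering: a vertex of low degree in `S` is ranked last and the rest of `S` is ordered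
by induction. -/
lemma exists_rank_of_forall_exists_degree_le {V : Type*} (G : SimpleGraph V)
    (D : ℝ) (M : Finset V → V → Finset V) (hM : ∀ S v u, u ∈ M S v ↔ u ∈ S ∧ G.Adj v u)
    (h : ∀ S : Finset V, S.Nonempty → ∃ v ∈ S, ((M S v).card : ℝ) ≤ D) (S : Finset V) :
    ∃ f : V → ℕ, Set.InjOn f S ∧ ∀ v ∈ S, ((Finset.card {u ∈ M S v | f u < f v} : ℕ) : ℝ) ≤ D := by
  classical
  induction S using Finset.strongInduction with
  | H S ih =>
    rcases S.eq_empty_or_nonempty with rfl | hS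
    · exact ⟨fun _ => 0, by simp, by simp⟩
    obtain ⟨v, hv, hvD⟩ := h S hS
    obtain ⟨f, hf, hfD⟩ := ih (S.erase v) (Finset.erase_ssubset hv)
    have hlt : ∀ u ∈ S, f u < S.sup f + 1 := fun u hu => Nat.lt_succ_of_le (Finset.le_sup hu)
    refine ⟨Function.update f v (S.sup f + 1), ?_, ?_⟩
    · intro a ha b hb hab
      by_cases h1 : a = v <;> by_cases h2 : b = v
      · rw [h1, h2]
      · subst h1
        rw [Function.update_self, Function.update_of_ne h2] at hab
        exact absurd hab (hlt b hb).ne'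
      · subst h2
        rw [Function.update_self, Function.update_of_ne h1] at hab
        exact absurd hab (hlt a ha).ne
      · rw [Function.update_of_ne h1, Function.update_of_ne h2] at hab
        exact hf (Finset.mem_coe.2 (Finset.mem_erase.2 ⟨h1, ha⟩))
          (Finset.mem_coe.2 (Finset.mem_erase.2 ⟨h2, hb⟩)) hab
    · intro u hu
      by_cases h1 : u = v
      · subst h1
        refine le_trans ?_ hvD
        exact_mod_cast Finset.card_filter_le _ _
      · refine le_trans ?_ (hfD u (Finset.mem_erase.2 ⟨h1, hu⟩))
        norm_cast
        refine Finset.card_le_card fun w hw => ?_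
        rw [Finset.mem_filter, hM] at hw
        rw [Function.update_of_ne h1] at hw
        have hwv : w ≠ v := by
          rintro rfl
          rw [Function.update_self] at hw
          exact lt_asymm hw.2 (hlt u hu)
        rw [Function.update_of_ne hwv] at hw
        rw [Finset.mem_filter, hM, Finset.mem_erase]
        exact ⟨⟨⟨hwv, hw.1.1⟩, hw.1.2⟩, hw.2⟩

/-! ### From `H`-freeness to local sparsity, and the lower bound -/

/-- A copy of `H - v` among neighbours of `x` extends to a copy of `H` by sending `v` to `x`, which
is not in `T`. -/
lemma free_induce_of_forall_adj {V W : Type*} {G : SimpleGraph V} {H : SimpleGraph W}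
    (hG : H.Free G) (v : W) (x : V) (T : Set V) (hT : ∀ u ∈ T, G.Adj x u) :
    (H.induce ({v}ᶜ : Set W)).Free (G.induce T) := by
  classical
  rintro ⟨f⟩
  refine hG ⟨⟨⟨fun w => if h : w = v then x else (f ⟨w, h⟩ : T), ?_⟩, ?_⟩⟩
  · intro a b hab
    by_cases ha : a = v <;> by_cases hb : b = v
    · exact absurd (ha.trans hb.symm) hab.ne
    · simp only [ha, hb, dif_pos, dif_neg, not_false_eq_true]
      exact hT _ (Subtype.coe_prop _)
    · simp only [ha, hb, dif_pos, dif_neg, not_false_eq_true]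
      exact (hT _ (Subtype.coe_prop _)).symm
    · simp only [ha, hb, dif_neg, not_false_eq_true]
      have : (H.induce ({v}ᶜ : Set W)).Adj ⟨a, ha⟩ ⟨b, hb⟩ := hab
      exact f.toHom.map_adj this
  · intro a b hab
    change (if h : a = v then x else ((f ⟨a, h⟩ : T) : V)) =
      (if h : b = v then x else ((f ⟨b, h⟩ : T) : V)) at hab
    by_cases ha : a = v <;> by_cases hb : b = v
    · exact ha.trans hb.symm
    · simp only [ha, hb, dif_pos, dif_neg, not_false_eq_true] at hab
      exact absurd hab (hT _ (Subtype.coe_prop _)).ne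
    · simp only [ha, hb, dif_pos, dif_neg, not_false_eq_true] at hab
      exact absurd hab.symm (hT _ (Subtype.coe_prop _)).ne
    · simp only [ha, hb, dif_neg, not_false_eq_true] at hab
      have := f.injective (Subtype.ext hab)
      exact congrArg Subtype.val this

/-- The factor `2` appears because `LocallySparse` sums over ordered pairs. -/
lemma locallySparse_of_free {V W : Type*} {G : SimpleGraph V} {H : SimpleGraph W}
    (hG : H.Free G) (v : W) {C : ℝ}
    (hC : ∀ n : ℕ, (SimpleGraph.extremalNumber n (H.induce ({v}ᶜ : Set W)) : ℝ) ≤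
      C * (n * √(n : ℝ))) : LocallySparse G (2 * C) := by
  classical
  intro x T hT
  have h1 := SimpleGraph.card_edgeFinset_le_extremalNumber
    (free_induce_of_forall_adj hG v x (T : Set V) hT)
  have h2 := two_mul_edgeCount (G.induce (T : Set V))
  rw [← edgeCount_eq_card_edgeFinset] at h1
  have h3 := (Nat.cast_le (α := ℝ).2 h1).trans (hC _)
  simp only [Finset.coe_sort_coe, Fintype.card_coe] at h3
  have h4 : ∑ u ∈ T, ∑ w ∈ T, adj G u w =
      ∑ u : (T : Set V), ∑ w : (T : Set V), adj (G.induce (T : Set V)) u w := by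
    rw [← Finset.sum_coe_sort]
    refine Finset.sum_congr rfl fun u _ => ?_
    rw [← Finset.sum_coe_sort]
    rfl
  rw [h4, ← h2]
  linarith

lemma exists_extremalNumber_le {W : Type*} {B : SimpleGraph W}
    (hex : (fun n : ℕ => (SimpleGraph.extremalNumber n B : ℝ))
      =O[atTop] fun n : ℕ => (n : ℝ) ^ (3 / 2 : ℝ)) :
    ∃ C : ℝ, ∀ n : ℕ, (SimpleGraph.extremalNumber n B : ℝ) ≤ C * (n * √(n : ℝ)) := by
  classical
  have hpow : ∀ n : ℕ, (n : ℝ) ^ (3 / 2 : ℝ) = n * √(n : ℝ) := by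
    intro n
    rcases Nat.eq_zero_or_pos n with rfl | hn
    · norm_num
    · rw [Real.sqrt_eq_rpow, ← Real.rpow_one_add' (by positivity) (by norm_num)]
      norm_num
  obtain ⟨C, hC⟩ := (isBigO_nat_atTop_iff (by
    intro n hn
    rw [hpow] at hn
    have : n = 0 := by
      rcases mul_eq_zero.1 hn with h | h
      · exact_mod_cast h
      · exact_mod_cast (Real.sqrt_eq_zero (Nat.cast_nonneg n)).1 h
    subst this
    rw [Nat.cast_eq_zero, ← Nat.le_zero]
    have := SimpleGraph.extremalNumber_le_iff (V := Fin 0) B 0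
    rw [Fintype.card_fin] at this
    rw [this]
    intro G _ _
    simpa using G.card_edgeFinset_le_card_choose_two)).1 hex
  refine ⟨C, fun n => ?_⟩
  have := hC n
  rw [hpow, Real.norm_of_nonneg (by positivity), Real.norm_of_nonneg (by positivity)] at this
  exact this

/-- A locally sparse graph with `m` edges has surplus of order at least `m ^ (4 / 5)`. -/
lemma exists_le_surplus_of_locallySparse {C : ℝ} (hC : 0 < C) :
    ∃ c : ℝ, 0 < c ∧ ∀ (n : ℕ) (G : SimpleGraph (Fin n)), LocallySparse G C →
      c * (edgeCount G : ℝ) ^ (4 / 5 : ℝ) ≤ surplus G := by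
  classical
  set η := Real.exp (-2) with hη
  have hη0 : 0 < η := Real.exp_pos _
  -- In the degenerate case this keeps the triangle loss `ε² C` below half the gain `η ε`.
  set ε := min 1 (η / (2 * C)) with hε
  have hε0 : 0 < ε := lt_min one_pos (by positivity)
  have hε1 : ε ≤ 1 := min_le_left _ _
  have hεC : ε * C ≤ η / 2 := by
    have : ε ≤ η / (2 * C) := min_le_right _ _
    rw [le_div_iff₀ (by positivity)] at this
    linarith
  -- Chosen so that `|S| ≤ 2 t³` yields the hypothesis `hDS` of `surplus_of_minDegree`.
  set K := max 1 (4 * C / η) with hK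
  have hK1 : 1 ≤ K := le_max_left _ _
  have hKC : 4 * C ≤ η * K := by
    have : 4 * C / η ≤ K := le_max_right _ _
    rw [div_le_iff₀ hη0] at this
    linarith
  have hK0 : 0 < K := by linarith
  refine ⟨min (η * ε / (4 * √K)) (η / 8), by positivity, ?_⟩
  intro n G hG
  rcases Nat.eq_zero_or_pos (edgeCount G) with hm | hm
  · have h := neg_quadForm_le_surplus G 0 (by simp)
    rw [hm, Nat.cast_zero, Real.zero_rpow (by norm_num), mul_zero]
    simpa [quadForm] using h
  have hm0 : (0 : ℝ) < edgeCount G := by exact_mod_cast hm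
  set t : ℝ := (edgeCount G : ℝ) ^ (1 / 5 : ℝ) with ht
  have ht0 : 0 < t := Real.rpow_pos_of_pos hm0 _
  have ht4 : (edgeCount G : ℝ) ^ (4 / 5 : ℝ) = t ^ 4 := by
    rw [ht, ← Real.rpow_natCast, ← Real.rpow_mul hm0.le]; norm_num
  have ht5 : (edgeCount G : ℝ) = t ^ 5 := by
    rw [ht, ← Real.rpow_natCast, ← Real.rpow_mul hm0.le]; norm_num
  rw [ht4]
  -- With `m = t⁵`, the order `t²` balances the two gains: `m / √D` and `D²` are both of order `t⁴`.
  set D := K * t ^ 2 with hD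
  have hD0 : 0 < D := by positivity
  have hsD : √D = √K * t := by
    rw [hD, Real.sqrt_mul hK0.le, Real.sqrt_sq ht0.le]
  have hsK : 1 ≤ √K := Real.one_le_sqrt.2 hK1
  let M : Finset (Fin n) → Fin n → Finset (Fin n) := fun S v => {u ∈ S | G.Adj v u}
  have hM : ∀ S v u, u ∈ M S v ↔ u ∈ S ∧ G.Adj v u := fun S v u => by simp [M]
  by_cases h : ∀ S : Finset (Fin n), S.Nonempty → ∃ v ∈ S, ((M S v).card : ℝ) ≤ D
  · obtain ⟨f, hf, hfD⟩ := exists_rank_of_forall_exists_degree_le G D M hM h Finset.univ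
    have := surplus_of_degenerate hC.le hG hD0 f (by simpa using hf)
      (fun v => {u ∈ M Finset.univ v | f u < f v}) (fun v u => by simp [M])
      (fun v => hfD v (Finset.mem_univ v)) hε0.le hε1
    refine le_trans ?_ this
    have h1 : η * ε / 2 ≤ η * ε - ε ^ 2 * C := by nlinarith
    calc min (η * ε / (4 * √K)) (η / 8) * t ^ 4 ≤ η * ε / (4 * √K) * t ^ 4 := by
          gcongr; exact min_le_left _ _
      _ = (η * ε / 2) * (2 * edgeCount G / √D) / 4 := by
          rw [hsD, ht5]; field_simp
      _ ≤ _ := by gcongr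
  · push Not at h
    obtain ⟨S, hS, hSD⟩ := h
    have hSm : (S.card : ℝ) * D ≤ 2 * edgeCount G := by
      rw [two_mul_edgeCount]
      calc (S.card : ℝ) * D ≤ ∑ v ∈ S, ((M S v).card : ℝ) := by
            rw [← nsmul_eq_mul]
            exact Finset.card_nsmul_le_sum _ _ _ fun v hv => (hSD v hv).le
        _ ≤ ∑ v ∈ S, ∑ u, adj G v u := by
            refine Finset.sum_le_sum fun v _ => ?_
            rw [Finset.card_filter]
            push_cast
            refine le_trans ?_ (Finset.sum_le_sum_of_subset_of_nonneg (Finset.subset_univ S)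
              fun _ _ _ => adj_nonneg _ _ _)
            exact Finset.sum_le_sum fun u _ => by rw [adj]
        _ ≤ _ := Finset.sum_le_sum_of_subset_of_nonneg (Finset.subset_univ S)
              fun _ _ _ => Finset.sum_nonneg fun _ _ => adj_nonneg _ _ _
    have hS0 : (0 : ℝ) ≤ S.card := Nat.cast_nonneg _
    have h1 : (S.card : ℝ) ≤ 2 * t ^ 3 := by
      rw [ht5, hD] at hSm
      have h2 : (S.card : ℝ) * t ^ 2 ≤ (S.card : ℝ) * (K * t ^ 2) := by
        refine mul_le_mul_of_nonneg_left ?_ hS0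
        nlinarith [sq_nonneg t]
      have h3 : (S.card : ℝ) * t ^ 2 ≤ (2 * t ^ 3) * t ^ 2 := by nlinarith
      exact le_of_mul_le_mul_right h3 (by positivity)
    have := surplus_of_minDegree hC.le hG hD0 S hS (M S) (hM S) (fun v hv => (hSD v hv).le) (by
      rw [hsD, hD, ← hη]
      calc 2 * C * S.card ≤ 2 * C * (2 * t ^ 3) :=
            mul_le_mul_of_nonneg_left h1 (mul_pos two_pos hC).le
        _ = (4 * C) * t ^ 3 := by ring
        _ ≤ (η * K) * t ^ 3 := by gcongr
        _ ≤ (η * K) * t ^ 3 * √K := le_mul_of_one_le_right (by positivity) hsK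
        _ = η * (K * t ^ 2 * (√K * t)) := by ring)
    refine le_trans ?_ this
    rw [← hη, hD]
    calc min (η * ε / (4 * √K)) (η / 8) * t ^ 4 ≤ η / 8 * t ^ 4 := by
          gcongr; exact min_le_right _ _
      _ ≤ η / 8 * t ^ 4 * K ^ 2 := le_mul_of_one_le_right (by positivity) (by nlinarith)
      _ = _ := by ring

theorem exists_le_minSurplus {W : Type*} (H : SimpleGraph W) (v : W)
    (hex : (fun n : ℕ => (SimpleGraph.extremalNumber n (H.induce ({v}ᶜ : Set W)) : ℝ))
      =O[atTop] fun n : ℕ => (n : ℝ) ^ (3 / 2 : ℝ)) :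
    ∃ c : ℝ, 0 < c ∧ ∀ m : ℕ,
      ((c * (m : ℝ) ^ (4 / 5 : ℝ) : ℝ) : EReal) ≤ minSurplus m H := by
  obtain ⟨C, hC⟩ := exists_extremalNumber_le hex
  obtain ⟨c, hc, h⟩ := exists_le_surplus_of_locallySparse (C := 2 * max C 1) (by positivity)
  refine ⟨c, hc, fun m => le_minSurplus fun n G hG hm => ?_⟩
  rw [← hm]
  refine h n G (locallySparse_of_free hG v fun k => (hC k).trans ?_)
  gcongr
  exact le_max_left _ _

/-! ### Disjoint unions: from prime parameters to every number of edges -/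

lemma sum_adj_sum {V V' : Type*} [Fintype V] [Fintype V'] (G : SimpleGraph V)
    (G' : SimpleGraph V') (c : V ⊕ V' → V ⊕ V' → ℝ) :
    ∑ u, ∑ v, adj (G.sum G') u v * c u v =
      ∑ u, ∑ v, adj G u v * c (.inl u) (.inl v) +
        ∑ u, ∑ v, adj G' u v * c (.inr u) (.inr v) := by
  classical
  have h1 : ∀ u v, adj (G.sum G') (.inl u) (.inl v) = adj G u v := fun u v =>
    if_congr (SimpleGraph.sum_adj_inl) rfl rfl
  have h2 : ∀ u v, adj (G.sum G') (.inr u) (.inr v) = adj G' u v := fun u v =>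
    if_congr (SimpleGraph.sum_adj_inr) rfl rfl
  have h3 : ∀ u v, adj (G.sum G') (.inl u) (.inr v) = 0 := fun u v =>
    adj_of_not_adj (SimpleGraph.not_adj_sum_inl_inr u v)
  have h4 : ∀ u v, adj (G.sum G') (.inr u) (.inl v) = 0 := fun u v => by
    rw [adj_comm, h3]
  simp [Fintype.sum_sum_type, h1, h2, h3, h4]

lemma edgeCount_sum {V V' : Type*} [Fintype V] [Fintype V'] (G : SimpleGraph V)
    (G' : SimpleGraph V') : edgeCount (G.sum G') = edgeCount G + edgeCount G' := by
  have h := sum_adj_sum G G' fun _ _ => 1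
  simp only [mul_one, ← two_mul_edgeCount] at h
  have : (edgeCount (G.sum G') : ℝ) = edgeCount G + edgeCount G' := by linarith
  exact_mod_cast this

lemma surplus_sum_le {V V' : Type*} [Fintype V] [Fintype V'] (G : SimpleGraph V)
    (G' : SimpleGraph V') : surplus (G.sum G') ≤ surplus G + surplus G' := by
  refine surplus_le _ _ fun y hy => ?_
  have hy' : ∀ v, |y v| ≤ 1 := fun v => by rcases hy v with h | h <;> simp [h]
  have h := sum_adj_sum G G' fun u v => y u * y v
  have h1 := neg_quadForm_le_surplus G (fun v => y (.inl v)) fun v => hy' _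
  have h2 := neg_quadForm_le_surplus G' (fun v => y (.inr v)) fun v => hy' _
  simp only [quadForm] at *
  linarith

lemma free_sum {U V V' : Type*} {F : SimpleGraph U} {G : SimpleGraph V} {G' : SimpleGraph V'}
    (hF : F.Connected) (hG : F.Free G) (hG' : F.Free G') : F.Free (G.sum G') := by
  rintro ⟨f⟩
  have hreach : ∀ a b, (G.sum G').Reachable (f a) (f b) := fun a b =>
    (hF.preconnected a b).map f.toHom
  obtain ⟨a⟩ := hF.nonempty
  rcases ha : f a with x | x
  · have : ∀ b, ∃ z, f b = .inl z := fun b => by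
      rcases hb : f b with z | z
      · exact ⟨z, rfl⟩
      · have := hreach a b
        rw [ha, hb] at this
        exact absurd this (SimpleGraph.not_reachable_sum_inl_inr _ _)
    choose g hg using this
    refine hG ⟨⟨⟨g, fun {u v} huv => ?_⟩, fun u v huv => ?_⟩⟩
    · have : (G.sum G').Adj (f u) (f v) := f.toHom.map_adj huv
      rwa [hg, hg, SimpleGraph.sum_adj_inl] at this
    · change g u = g v at huv
      exact f.injective ((hg u).trans ((congrArg _ huv).trans (hg v).symm))
  · have : ∀ b, ∃ z, f b = .inr z := fun b => by
      rcases hb : f b with z | z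
      · have := hreach b a
        rw [ha, hb] at this
        exact absurd this (SimpleGraph.not_reachable_sum_inl_inr _ _)
      · exact ⟨z, rfl⟩
    choose g hg using this
    refine hG' ⟨⟨⟨g, fun {u v} huv => ?_⟩, fun u v huv => ?_⟩⟩
    · have : (G.sum G').Adj (f u) (f v) := f.toHom.map_adj huv
      rwa [hg, hg, SimpleGraph.sum_adj_inr] at this
    · change g u = g v at huv
      exact f.injective ((hg u).trans ((congrArg _ huv).trans (hg v).symm))

/-- From a family of `F`-free graphs of small surplus, indexed by primes, to `F`-free graphs of
small surplus with a positive proportion of the edges allowed. -/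
lemma exists_free_of_prime_family {U : Type*} [Fintype U] {F : SimpleGraph U}
    (hU : 2 < Fintype.card U) {c C : ℝ} (hc : 0 < c) (hC : 0 ≤ C) (p₀ : ℕ)
    (h : ∀ p : ℕ, p.Prime → p₀ ≤ p → ∃ (V : Type) (_ : Fintype V) (G : SimpleGraph V), F.Free G ∧
      c * (p : ℝ) ^ 5 ≤ edgeCount G ∧ (edgeCount G : ℝ) ≤ (p : ℝ) ^ 5 ∧
      surplus G ≤ C * (p : ℝ) ^ 4) :
    ∃ c₁ : ℝ, 0 < c₁ ∧ ∀ m : ℕ, 0 < m → ∃ (V : Type) (_ : Fintype V) (G : SimpleGraph V),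
      F.Free G ∧ c₁ * m ≤ edgeCount G ∧ edgeCount G ≤ m ∧
      surplus G ≤ (C + 1) * (m : ℝ) ^ (4 / 5 : ℝ) := by
  -- Beyond this threshold, Bertrand's postulate applied at `⌊r / 2⌋` gives a prime `p ≥ p₀` with `r
  -- / 2 ≤ p ≤ r`, whence the factor `2⁵ = 32`.
  set R : ℝ := 2 * ((p₀ : ℝ) + 1) with hR
  have hR0 : 0 < R := by positivity
  refine ⟨min (c / 32) (1 / R ^ 5), by positivity, fun m hm => ?_⟩
  have hm1 : (1 : ℝ) ≤ m := by exact_mod_cast hm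
  have hm0 : (0 : ℝ) < m := by linarith
  set r : ℝ := (m : ℝ) ^ (1 / 5 : ℝ) with hr
  have hr1 : 1 ≤ r := Real.one_le_rpow hm1 (by norm_num)
  have hr4 : (m : ℝ) ^ (4 / 5 : ℝ) = r ^ 4 := by
    rw [hr, ← Real.rpow_natCast, ← Real.rpow_mul hm0.le]; norm_num
  have hr5 : (m : ℝ) = r ^ 5 := by
    rw [hr, ← Real.rpow_natCast, ← Real.rpow_mul hm0.le]; norm_num
  rw [hr4]
  by_cases hrR : R ≤ r
  · set n := ⌊r / 2⌋₊ with hn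
    have hn1 : p₀ + 1 ≤ n := by
      apply Nat.le_floor
      push_cast
      linarith
    obtain ⟨p, hp, hnp, hpn⟩ := Nat.exists_prime_lt_and_le_two_mul n (by omega)
    obtain ⟨V, hV, G, hG, h1, h2, h3⟩ := h p hp (by omega)
    have hpr : (p : ℝ) ≤ r := by
      have e1 : (n : ℝ) ≤ r / 2 := Nat.floor_le (by linarith)
      have e2 : (p : ℝ) ≤ 2 * n := by exact_mod_cast hpn
      linarith
    have hrp : r / 2 ≤ p := by
      have e1 : r / 2 < n + 1 := Nat.lt_floor_add_one _
      have e2 : (n : ℝ) + 1 ≤ p := by exact_mod_cast hnp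
      linarith
    refine ⟨V, hV, G, hG, ?_, ?_, ?_⟩
    · refine le_trans ?_ h1
      calc min (c / 32) (1 / R ^ 5) * m ≤ c / 32 * m := by gcongr; exact min_le_left _ _
        _ = c * (r / 2) ^ 5 := by rw [hr5]; ring
        _ ≤ c * (p : ℝ) ^ 5 := by gcongr
    · have : (edgeCount G : ℝ) ≤ m := h2.trans (by rw [hr5]; gcongr)
      exact_mod_cast this
    · calc surplus G ≤ C * (p : ℝ) ^ 4 := h3
        _ ≤ (C + 1) * r ^ 4 := by gcongr; linarith
  · push Not at hrR
    -- For bounded `m` a single edge is enough; it is `F`-free since `F` has more than two vertices.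
    have he : edgeCount (⊤ : SimpleGraph (Fin 2)) = 1 := by
      classical
      rw [edgeCount_eq_card_edgeFinset]
      decide
    refine ⟨Fin 2, inferInstance, ⊤, ?_, ?_, ?_, ?_⟩
    · rintro ⟨f⟩
      have := Fintype.card_le_of_injective f f.injective
      rw [Fintype.card_fin] at this
      omega
    · rw [he, Nat.cast_one, hr5]
      calc min (c / 32) (1 / R ^ 5) * r ^ 5 ≤ 1 / R ^ 5 * R ^ 5 := by
            gcongr; exact min_le_right _ _
        _ = 1 := by field_simp
    · rw [he]; exact hm
    · refine surplus_le _ _ fun y hy => ?_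
      have h4 : 1 ≤ (C + 1) * r ^ 4 := by
        have := one_le_pow₀ hr1 (n := 4)
        nlinarith
      refine le_trans ?_ h4
      simp only [quadForm, Fin.sum_univ_two]
      have a0 : ∀ v, adj (⊤ : SimpleGraph (Fin 2)) v v = 0 := fun v =>
        adj_of_not_adj (SimpleGraph.irrefl _)
      have a1 : adj (⊤ : SimpleGraph (Fin 2)) 0 1 = 1 := adj_of_adj (by simp)
      rw [a0, a0, adj_comm _ 1 0, a1]
      rcases hy 0 with h | h <;> rcases hy 1 with h' | h' <;> rw [h, h'] <;> norm_num

/-- Greedy filling: each step uses a proportion at least `c₁` of the remaining edges, so the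
surpluses are dominated by a geometric series of ratio `ρ = (1 - c₁)^{4/5}`. Connectedness of `F`
keeps the disjoint unions `F`-free. -/
lemma exists_free_surplus_le {U : Type*} [Fintype U] {F : SimpleGraph U} (hF : F.Connected)
    (hU : 2 < Fintype.card U) {c C : ℝ} (hc : 0 < c) (hC : 0 ≤ C) (p₀ : ℕ)
    (h : ∀ p : ℕ, p.Prime → p₀ ≤ p → ∃ (V : Type) (_ : Fintype V) (G : SimpleGraph V), F.Free G ∧
      c * (p : ℝ) ^ 5 ≤ edgeCount G ∧ (edgeCount G : ℝ) ≤ (p : ℝ) ^ 5 ∧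
      surplus G ≤ C * (p : ℝ) ^ 4) :
    ∃ C' : ℝ, 0 < C' ∧ ∀ m : ℕ, ∃ (V : Type) (_ : Fintype V) (G : SimpleGraph V),
      F.Free G ∧ edgeCount G = m ∧ surplus G ≤ C' * (m : ℝ) ^ (4 / 5 : ℝ) := by
  obtain ⟨c₁, hc₁, h₁⟩ := exists_free_of_prime_family hU hc hC p₀ h
  have hc₁1 : c₁ ≤ 1 := by
    obtain ⟨V, _, G, -, h2, h3, -⟩ := h₁ 1 one_pos
    have : (edgeCount G : ℝ) ≤ 1 := by exact_mod_cast h3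
    push_cast at h2
    linarith
  set ρ : ℝ := (1 - c₁) ^ (4 / 5 : ℝ) with hρ
  have hρ1 : ρ < 1 := Real.rpow_lt_one (by linarith) (by linarith) (by norm_num)
  refine ⟨(C + 1) / (1 - ρ), div_pos (by linarith) (by linarith), fun m => ?_⟩
  induction m using Nat.strong_induction_on with
  | _ m ih =>
    rcases Nat.eq_zero_or_pos m with rfl | hm
    · refine ⟨Fin 0, inferInstance, ⊥, ?_, ?_, ?_⟩
      · rintro ⟨f⟩
        obtain ⟨a⟩ := hF.nonempty
        exact (f a).elim0
      · simp [edgeCount]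
      · refine surplus_le _ _ fun y _ => ?_
        rw [Nat.cast_zero, Real.zero_rpow (by norm_num)]
        simp [quadForm]
    · obtain ⟨V, _, G, hG, h2, h3, h4⟩ := h₁ m hm
      have hm0 : (0 : ℝ) < m := by exact_mod_cast hm
      have he : 0 < edgeCount G := by
        have : (0 : ℝ) < edgeCount G := (mul_pos hc₁ hm0).trans_le h2
        exact_mod_cast this
      obtain ⟨V', _, G', hG', h5, h6⟩ := ih (m - edgeCount G) (by omega)
      refine ⟨V ⊕ V', inferInstance, G.sum G', free_sum hF hG hG', ?_, ?_⟩
      · rw [edgeCount_sum, h5]; omega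
      · refine (surplus_sum_le _ _).trans ?_
        have e1 : ((m - edgeCount G : ℕ) : ℝ) ^ (4 / 5 : ℝ) ≤ ρ * (m : ℝ) ^ (4 / 5 : ℝ) := by
          rw [hρ, ← Real.mul_rpow (by linarith) hm0.le]
          refine Real.rpow_le_rpow (by positivity) ?_ (by norm_num)
          rw [Nat.cast_sub h3]
          linarith
        have e2 : (C + 1) / (1 - ρ) * ((m - edgeCount G : ℕ) : ℝ) ^ (4 / 5 : ℝ) ≤
            (C + 1) / (1 - ρ) * (ρ * (m : ℝ) ^ (4 / 5 : ℝ)) :=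
          mul_le_mul_of_nonneg_left e1 (div_nonneg (by linarith) (by linarith))
        have e3 : (C + 1) * (m : ℝ) ^ (4 / 5 : ℝ) +
            (C + 1) / (1 - ρ) * (ρ * (m : ℝ) ^ (4 / 5 : ℝ)) =
            (C + 1) / (1 - ρ) * (m : ℝ) ^ (4 / 5 : ℝ) := by
          have : 1 - ρ ≠ 0 := by linarith
          field_simp
          ring
        linarith

lemma exists_minSurplus_le_of_contained {U W : Type*} {F : SimpleGraph U} {H : SimpleGraph W}
    (hFH : F.IsContained H)
    (h : ∃ C' : ℝ, 0 < C' ∧ ∀ m : ℕ, ∃ (V : Type) (_ : Fintype V) (G : SimpleGraph V),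
      F.Free G ∧ edgeCount G = m ∧ surplus G ≤ C' * (m : ℝ) ^ (4 / 5 : ℝ)) :
    ∃ C : ℝ, 0 < C ∧ ∀ m : ℕ,
      minSurplus m H ≤ ((C * (m : ℝ) ^ (4 / 5 : ℝ) : ℝ) : EReal) := by
  obtain ⟨C, hC, h⟩ := h
  refine ⟨C, hC, fun m => ?_⟩
  obtain ⟨V, _, G, hG, hm, hs⟩ := h m
  have := minSurplus_le (H := H) (G := G) fun hc => hG (hFH.trans hc)
  rw [hm] at this
  exact this.trans (by exact_mod_cast hs)

lemma connected_completeBipartiteGraph {α β : Type*} [Nonempty α] [Nonempty β] :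
    (completeBipartiteGraph α β).Connected := by
  obtain ⟨a₀⟩ := ‹Nonempty α›
  obtain ⟨b₀⟩ := ‹Nonempty β›
  have h : ∀ a b, (completeBipartiteGraph α β).Reachable (.inl a) (.inr b) := fun a b =>
    SimpleGraph.Adj.reachable (by simp)
  have h0 : ∀ x, (completeBipartiteGraph α β).Reachable (.inl a₀) x := by
    rintro (a | b)
    · exact (h a₀ b₀).trans (h a b₀).symm
    · exact h a₀ b
  exact { preconnected := fun x y => (h0 x).symm.trans (h0 y), nonempty := ⟨.inl a₀⟩ }

/-! ### Random signs -/

/-- The sign `±1` of a Boolean. -/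
def boolSign (b : Bool) : ℝ := if b then 1 else -1

lemma boolSign_sq (b : Bool) : boolSign b ^ 2 = 1 := by
  cases b <;> simp [boolSign]

/-- Writes `exp (s²)` as a Gaussian mixture of exponentials linear in `s`, which factor over
independent signs. -/
lemma integral_exp_linear_sub_sq (s : ℝ) :
    MeasureTheory.Integrable (fun x : ℝ => Real.exp (2 * x * s - x ^ 2)) ∧
      ∫ x : ℝ, Real.exp (2 * x * s - x ^ 2) = √Real.pi * Real.exp (s ^ 2) := by
  have h : ∀ x : ℝ, Real.exp (2 * x * s - x ^ 2) =
      Real.exp (s ^ 2) * Real.exp (-1 * (x - s) ^ 2) := fun x => by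
    rw [← Real.exp_add]; congr 1; ring
  simp only [h]
  refine ⟨((integrable_exp_neg_mul_sq one_pos).comp_sub_right s).const_mul _, ?_⟩
  rw [MeasureTheory.integral_const_mul,
    MeasureTheory.integral_sub_right_eq_self (fun x : ℝ => Real.exp (-1 * x ^ 2)) s,
    integral_gaussian, div_one, mul_comm]

/-- A subgaussian estimate for the square of a Rademacher sum. -/
lemma sum_exp_sq_le {T : Type*} [Fintype T] [DecidableEq T] [Nonempty T]
    (z : T → ℝ) (hz : ∀ t, z t ^ 2 ≤ 1) :
    ∑ ε : T → Bool, Real.exp ((∑ t, boolSign (ε t) * z t) ^ 2 / (4 * Fintype.card T)) ≤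
      √2 * 2 ^ Fintype.card T := by
  classical
  set p : ℝ := (Fintype.card T : ℝ) with hp
  have hp0 : 0 < p := by rw [hp]; exact_mod_cast Fintype.card_pos
  set q := √p with hq
  have hq0 : 0 < q := Real.sqrt_pos.2 hp0
  have hqp : q ^ 2 = p := Real.sq_sqrt hp0.le
  let S : (T → Bool) → ℝ := fun ε => ∑ t, boolSign (ε t) * z t
  -- For fixed `x` the sum over signs is a product of `2 cosh (x z_t / q)`, and `cosh a ≤ exp (a² /
  -- 2)` leaves half of the Gaussian decay.
  have h1 : ∀ x : ℝ, ∑ ε, Real.exp (2 * x * (S ε / (2 * q)) - x ^ 2) ≤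
      2 ^ Fintype.card T * Real.exp (-(1 / 2) * x ^ 2) := by
    intro x
    have e1 : ∀ ε, Real.exp (2 * x * (S ε / (2 * q)) - x ^ 2) =
        Real.exp (-x ^ 2) * ∏ t, Real.exp (boolSign (ε t) * (x * z t / q)) := by
      intro ε
      rw [← Real.exp_sum, ← Real.exp_add]
      congr 1
      have : ∑ t, boolSign (ε t) * (x * z t / q) = x / q * S ε := by
        simp only [S, Finset.mul_sum]
        exact Finset.sum_congr rfl fun t _ => by ring
      rw [this]
      field_simp
      ring
    have e2 : ∑ ε : T → Bool, ∏ t, Real.exp (boolSign (ε t) * (x * z t / q)) =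
        ∏ t, (2 * Real.cosh (x * z t / q)) := by
      have := Finset.prod_univ_sum (fun _ : T => (Finset.univ : Finset Bool))
        (fun t b => Real.exp (boolSign b * (x * z t / q)))
      rw [Fintype.piFinset_univ] at this
      rw [← this]
      refine Finset.prod_congr rfl fun t _ => ?_
      simp only [Fintype.sum_bool, boolSign, Real.cosh_eq]
      simp
      ring
    have e3 : ∀ t, 2 * Real.cosh (x * z t / q) ≤ 2 * Real.exp (x ^ 2 / (2 * p)) := by
      intro t
      refine mul_le_mul_of_nonneg_left ((Real.cosh_le_exp_half_sq _).trans ?_) zero_le_two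
      refine Real.exp_le_exp.2 ?_
      rw [div_pow, hqp, mul_pow, div_div, mul_comm p 2]
      gcongr
      nlinarith [hz t, sq_nonneg x]
    simp only [e1, ← Finset.mul_sum, e2]
    calc Real.exp (-x ^ 2) * ∏ t, (2 * Real.cosh (x * z t / q))
        ≤ Real.exp (-x ^ 2) * ∏ _t : T, (2 * Real.exp (x ^ 2 / (2 * p))) := by
          refine mul_le_mul_of_nonneg_left (Finset.prod_le_prod (fun t _ => ?_) fun t _ => e3 t)
            (Real.exp_pos _).le
          have := Real.cosh_pos (x * z t / q)
          linarith
      _ = 2 ^ Fintype.card T * Real.exp (-(1 / 2) * x ^ 2) := by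
          rw [Finset.prod_const, Finset.card_univ, mul_pow, ← Real.exp_nat_mul, mul_left_comm,
            ← Real.exp_add, ← hp]
          congr 2
          field_simp
          ring
  have h2 : ∑ ε, √Real.pi * Real.exp ((S ε / (2 * q)) ^ 2) ≤
      2 ^ Fintype.card T * √(Real.pi / (1 / 2)) := by
    rw [← integral_gaussian, ← MeasureTheory.integral_const_mul,
      ← Finset.sum_congr rfl fun ε _ => (integral_exp_linear_sub_sq (S ε / (2 * q))).2,
      ← MeasureTheory.integral_finsetSum _ fun ε _ => (integral_exp_linear_sub_sq _).1]
    exact MeasureTheory.integral_mono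
      (MeasureTheory.integrable_finsetSum _ fun ε _ => (integral_exp_linear_sub_sq _).1)
      ((integrable_exp_neg_mul_sq (by norm_num)).const_mul _) h1
  rw [← Finset.mul_sum, show Real.pi / (1 / 2) = Real.pi * 2 by ring,
    Real.sqrt_mul Real.pi_pos.le] at h2
  have hpi : 0 < √Real.pi := Real.sqrt_pos.2 Real.pi_pos
  have h3 : ∀ ε, Real.exp ((∑ t, boolSign (ε t) * z t) ^ 2 / (4 * p)) =
      Real.exp ((S ε / (2 * q)) ^ 2) := fun ε => by
    rw [div_pow, mul_pow, hqp]; norm_num [S]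
  simp only [h3]
  refine le_of_mul_le_mul_left (h2.trans_eq ?_) hpi
  ring

/-- A random choice of signs is nearly orthogonal to a given family of sign patterns. -/
lemma exists_sign_forall_sum_sq_le {L T Y : Type*} [Fintype L] [Nonempty L] [Fintype T]
    [Nonempty T] [Fintype Y] (hY : Fintype.card Y ≤ 2 ^ Fintype.card L)
    (z : Y → L → T → ℝ) (hz : ∀ y l t, z y l t ^ 2 ≤ 1) :
    ∃ ε : L → T → Bool, ∀ y, ∑ l, (∑ t, boolSign (ε l t) * z y l t) ^ 2 ≤
      8 * Fintype.card T * Fintype.card L := by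
  classical
  by_contra hcon
  push Not at hcon
  set p : ℝ := (Fintype.card T : ℝ) with hp
  set N := Fintype.card L with hN
  have hp0 : 0 < p := by rw [hp]; exact_mod_cast Fintype.card_pos
  let S : Y → (l : L) → (T → Bool) → ℝ := fun y l e => (∑ t, boolSign (e t) * z y l t) ^ 2 / (4 * p)
  -- Exponential Markov and a union bound over `y`: a violation has exponent at least `8 p N / (4 p)
  -- = 2 N`.
  have h1 : ∀ ε : L → T → Bool, Real.exp 2 ^ N ≤ ∑ y, ∏ l, Real.exp (S y l (ε l)) := by
    intro ε
    obtain ⟨y, hy⟩ := hcon ε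
    refine le_trans ?_ (Finset.single_le_sum (f := fun y => ∏ l, Real.exp (S y l (ε l)))
      (fun y _ => Finset.prod_nonneg fun l _ => (Real.exp_pos _).le) (Finset.mem_univ y))
    rw [← Real.exp_nat_mul, ← Real.exp_sum]
    refine Real.exp_le_exp.2 ?_
    simp only [S]
    rw [← Finset.sum_div, le_div_iff₀ (by positivity)]
    linarith
  have h2 : ∀ y, ∑ ε : L → T → Bool, ∏ l, Real.exp (S y l (ε l)) ≤
      (√2 * 2 ^ Fintype.card T) ^ N := by
    intro y
    have := Finset.prod_univ_sum (fun _ : L => (Finset.univ : Finset (T → Bool)))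
      (fun l e => Real.exp (S y l e))
    rw [Fintype.piFinset_univ] at this
    rw [← this]
    refine (Finset.prod_le_prod (fun l _ => Finset.sum_nonneg fun e _ => (Real.exp_pos _).le)
      fun l _ => sum_exp_sq_le (z y l) (hz y l)).trans_eq ?_
    rw [Finset.prod_const, Finset.card_univ]
  have h3 : ((2 : ℝ) ^ Fintype.card T) ^ N * Real.exp 2 ^ N ≤
      2 ^ N * (√2 * 2 ^ Fintype.card T) ^ N := by
    calc ((2 : ℝ) ^ Fintype.card T) ^ N * Real.exp 2 ^ N
        = ∑ _ε : L → T → Bool, Real.exp 2 ^ N := by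
          simp [Finset.sum_const, Finset.card_univ, hN]
      _ ≤ ∑ ε : L → T → Bool, ∑ y, ∏ l, Real.exp (S y l (ε l)) :=
          Finset.sum_le_sum fun ε _ => h1 ε
      _ = ∑ y, ∑ ε : L → T → Bool, ∏ l, Real.exp (S y l (ε l)) := Finset.sum_comm
      _ ≤ ∑ _y : Y, (√2 * 2 ^ Fintype.card T) ^ N := Finset.sum_le_sum fun y _ => h2 y
      _ = Fintype.card Y * (√2 * 2 ^ Fintype.card T) ^ N := by
          rw [Finset.sum_const, Finset.card_univ, nsmul_eq_mul]
      _ ≤ _ := by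
          refine mul_le_mul_of_nonneg_right ?_ (by positivity)
          exact_mod_cast hY
  rw [← mul_pow, ← mul_pow] at h3
  have h4 := le_of_pow_le_pow_left₀ (Fintype.card_ne_zero (α := L)) (by positivity) h3
  have h5 : (0 : ℝ) < 2 ^ Fintype.card T := by positivity
  -- Per element of `L`, the union bound costs `2` and the moment bound `√2`; but `e² ≥ 3 > 2√2`.
  have h6 : Real.exp 2 ≤ 2 * √2 := by
    refine le_of_mul_le_mul_left (h4.trans_eq ?_) h5
    ring
  have h7 := Real.add_one_le_exp (2 : ℝ)
  have h8 : √2 < 3 / 2 := by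
    rw [Real.sqrt_lt' (by norm_num)]; norm_num
  linarith

/-! ### Triangle-free graphs from a geometry of lines -/

section TriangleFree

variable {F : Type*} [Field F]

/-- The point with first coordinate `t` on the line `l`, in a partial linear space without
triangles. -/
def linePoint (l : F × F × F) (t : F) : F × F × F :=
  (t, t * l.1 - l.2.1, t * l.2.1 - l.2.2)

lemma linePoint_injective (l : F × F × F) : Function.Injective (linePoint l) :=
  fun _ _ h => congrArg Prod.fst h

/-- Three pairwise meeting lines agree if they meet in distinct points. -/
lemma lines_eq_of_triangle {l m n : F × F × F} {a b c : F} (hab : a ≠ b) (hbc : b ≠ c)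
    (hca : c ≠ a) (h1 : linePoint l a = linePoint n a) (h2 : linePoint l b = linePoint m b)
    (h3 : linePoint m c = linePoint n c) : l = m ∧ m = n := by
  obtain ⟨l1, l2, l3⟩ := l
  obtain ⟨m1, m2, m3⟩ := m
  obtain ⟨n1, n2, n3⟩ := n
  simp only [linePoint, Prod.mk.injEq, true_and] at *
  obtain ⟨h1, h1'⟩ := h1
  obtain ⟨h2, h2'⟩ := h2
  obtain ⟨h3, h3'⟩ := h3
  -- Lines meeting at parameter `t` differ by a multiple of `(1, t, t²)`. The three differences sum
  -- to zero, and such vectors for distinct `a`, `b`, `c` are independent by Vandermonde.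
  have k1 : (l1 - m1) * ((a - b) * (b - c)) = 0 := by
    linear_combination h1' - h2' - h3' + (a - b) * h2 + (a - c) * h3 - c * (h1 - h2 - h3)
  have k2 : (m1 - n1) * ((c - a) * (b - c)) = 0 := by
    linear_combination h1' - h2' - h3' + (a - b) * h2 + (a - c) * h3 - b * (h1 - h2 - h3)
  have k3 : l1 = m1 := by
    simpa [sub_eq_zero, hab, hbc] using k1
  have k4 : m1 = n1 := by
    simpa [sub_eq_zero, hca, hbc] using k2
  subst k3 k4
  have k5 : l2 = m2 := by linear_combination -h2
  have k6 : m2 = n2 := by linear_combination -h3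
  subst k5 k6
  have k7 : l3 = m3 := by linear_combination -h2'
  have k8 : m3 = n3 := by linear_combination -h3'
  subst k7 k8
  simp

/-- Two lines through two common points agree. -/
lemma lines_eq_of_two_points {l m : F × F × F} {a b : F} (hab : a ≠ b)
    (h1 : linePoint l a = linePoint m a) (h2 : linePoint l b = linePoint m b) : l = m := by
  obtain ⟨l1, l2, l3⟩ := l
  obtain ⟨m1, m2, m3⟩ := m
  simp only [linePoint, Prod.mk.injEq, true_and] at *
  obtain ⟨h1, h1'⟩ := h1
  obtain ⟨h2, h2'⟩ := h2
  have k1 : (l1 - m1) * (a - b) = 0 := by linear_combination h1 - h2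
  have k2 : l1 = m1 := by simpa [sub_eq_zero, hab] using k1
  subst k2
  have k3 : l2 = m2 := by linear_combination -h1
  subst k3
  have k4 : l3 = m3 := by linear_combination -h1'
  subst k4
  simp

/-- On each line, join the points of different signs. -/
def signGraph (ε : F × F × F → F → Bool) : SimpleGraph (F × F × F) where
  Adj u v := ∃ l a b, linePoint l a = u ∧ linePoint l b = v ∧ ε l a ≠ ε l b
  symm := ⟨fun _ _ ⟨l, a, b, h1, h2, h3⟩ => ⟨l, b, a, h2, h1, h3.symm⟩⟩
  loopless := ⟨fun _ ⟨l, _, _, h1, h2, h3⟩ =>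
    h3 (congrArg (ε l) (linePoint_injective l (h1.trans h2.symm)))⟩

/-- The first coordinate of a point is its parameter on every line through it, so a triangle would
have all its edges on one line, where the graph is bipartite. -/
lemma signGraph_triangleFree (ε : F × F × F → F → Bool) :
    (⊤ : SimpleGraph (Fin 3)).Free (signGraph ε) := by
  rintro ⟨f⟩
  have hadj : ∀ i j, i ≠ j → (signGraph ε).Adj (f i) (f j) := fun i j hij =>
    f.toHom.map_adj (by simpa using hij)
  obtain ⟨l, a, b, h1, h2, h3⟩ := hadj 0 1 (by decide)
  obtain ⟨m, b', c, h4, h5, h6⟩ := hadj 1 2 (by decide)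
  obtain ⟨n, c', a', h7, h8, h9⟩ := hadj 2 0 (by decide)
  have hb : b' = b := congrArg Prod.fst (h4.trans h2.symm)
  have hc : c' = c := congrArg Prod.fst (h7.trans h5.symm)
  have ha : a' = a := congrArg Prod.fst (h8.trans h1.symm)
  subst hb hc ha
  have hab : a' ≠ b' := fun h => h3 (congrArg _ h)
  have hbc : b' ≠ c' := fun h => h6 (congrArg _ h)
  have hca : c' ≠ a' := fun h => h9 (congrArg _ h)
  obtain ⟨rfl, rfl⟩ := lines_eq_of_triangle hab hbc hca (h1.trans h8.symm) (h2.trans h4.symm)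
    (h5.trans h7.symm)
  cases ha : ε l a' <;> cases hb : ε l b' <;> cases hc : ε l c' <;> simp_all

/-- Every edge lies on exactly one line, and on that line the indicator of different signs is `(1 -
ε_a ε_b) / 2`. Only the signed squares can make the form negative, and random signs keep them small.
-/
lemma quadForm_signGraph [Fintype F] (ε : F × F × F → F → Bool) (y : F × F × F → ℝ) :
    quadForm (signGraph ε) y = (∑ l, (∑ t, y (linePoint l t)) ^ 2 -
      ∑ l, (∑ t, boolSign (ε l t) * y (linePoint l t)) ^ 2) / 2 := by
  classical
  have h1 : quadForm (signGraph ε) y =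
      ∑ x : (F × F × F) × F × F with ε x.1 x.2.1 ≠ ε x.1 x.2.2,
        y (linePoint x.1 x.2.1) * y (linePoint x.1 x.2.2) := by
    have e : quadForm (signGraph ε) y =
        ∑ w : (F × F × F) × (F × F × F) with (signGraph ε).Adj w.1 w.2, y w.1 * y w.2 := by
      rw [Finset.sum_filter, Fintype.sum_prod_type, quadForm]
      refine Finset.sum_congr rfl fun u _ => Finset.sum_congr rfl fun v _ => ?_
      simp only [adj, ite_mul, one_mul, zero_mul]
    rw [e]
    symm
    refine Finset.sum_nbij (fun x => (linePoint x.1 x.2.1, linePoint x.1 x.2.2)) ?_ ?_ ?_ ?_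
    · rintro ⟨l, a, b⟩ h
      simp only [Finset.mem_filter, Finset.mem_univ, true_and] at h ⊢
      exact ⟨l, a, b, rfl, rfl, h⟩
    · rintro ⟨l, a, b⟩ h ⟨m, c, d⟩ _ heq
      simp only [Finset.coe_filter, Finset.mem_univ, true_and, Set.mem_ofPred_eq] at h
      simp only [Prod.mk.injEq] at heq
      have hac : a = c := congrArg Prod.fst heq.1
      have hbd : b = d := congrArg Prod.fst heq.2
      subst hac hbd
      have := lines_eq_of_two_points (fun hab => h (congrArg _ hab)) heq.1 heq.2
      rw [this]
    · rintro ⟨u, v⟩ h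
      simp only [Finset.coe_filter, Finset.mem_univ, true_and, Set.mem_ofPred_eq] at h
      obtain ⟨l, a, b, rfl, rfl, hab⟩ := h
      exact ⟨(l, a, b), by simpa using hab, rfl⟩
    · intro _ _
      rfl
  rw [h1, Finset.sum_filter, Fintype.sum_prod_type, ← Finset.sum_sub_distrib, Finset.sum_div]
  refine Finset.sum_congr rfl fun l _ => ?_
  rw [Fintype.sum_prod_type, sq, sq, Finset.sum_mul_sum, Finset.sum_mul_sum,
    ← Finset.sum_sub_distrib, Finset.sum_div]
  refine Finset.sum_congr rfl fun a _ => ?_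
  rw [← Finset.sum_sub_distrib, Finset.sum_div]
  refine Finset.sum_congr rfl fun b _ => ?_
  cases ε l a <;> cases ε l b <;> simp [boolSign]

/-- Triangle-free graphs of small surplus. -/
lemma exists_triangleFree_of_prime (p : ℕ) (hp : p.Prime) (hp16 : 16 ≤ p) :
    ∃ (V : Type) (_ : Fintype V) (G : SimpleGraph V), (⊤ : SimpleGraph (Fin 3)).Free G ∧
      1 / 8 * (p : ℝ) ^ 5 ≤ edgeCount G ∧ (edgeCount G : ℝ) ≤ (p : ℝ) ^ 5 ∧
      surplus G ≤ 1 * (p : ℝ) ^ 4 := by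
  classical
  have : Fact p.Prime := ⟨hp⟩
  let P := ZMod p × ZMod p × ZMod p
  have hP : Fintype.card P = p ^ 3 := by
    simp only [P, Fintype.card_prod, ZMod.card]; ring
  obtain ⟨ε, hε⟩ := exists_sign_forall_sum_sq_le (L := P) (T := ZMod p) (Y := P → Bool)
    (by simp) (fun y l t => boolSign (y (linePoint l t))) (fun y l t => (boolSign_sq _).le)
  simp only [hP, ZMod.card] at hε
  have hp16' : (16 : ℝ) ≤ p := by exact_mod_cast hp16
  have h1 := two_mul_edgeCount (signGraph ε)
  -- The constant vector computes the number of edges: at least `(p⁵ - 8 p⁴) / 4`, which is at least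
  -- `p⁵ / 8` once `p ≥ 16`.
  have h2 := quadForm_signGraph ε fun _ => 1
  simp only [quadForm, mul_one] at h2
  rw [← h1] at h2
  simp only [Finset.sum_const, Finset.card_univ, ZMod.card, nsmul_eq_mul, mul_one] at h2
  have h3 := hε fun _ => true
  simp only [boolSign, if_true, mul_one] at h3
  have h4 : 0 ≤ ∑ l, (∑ t, boolSign (ε l t)) ^ 2 := Finset.sum_nonneg fun _ _ => sq_nonneg _
  simp only [boolSign] at h4 h2
  have h5 : (Fintype.card P : ℝ) = p ^ 3 := by rw [hP]; push_cast; ring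
  change 2 * (edgeCount (signGraph ε) : ℝ) = ((Fintype.card P : ℝ) * (p : ℝ) ^ 2 - _) / 2 at h2
  rw [h5] at h2
  push_cast at h3
  have h6 : (16 : ℝ) * p ^ 4 ≤ p ^ 5 := by
    have : (0 : ℝ) ≤ (p : ℝ) ^ 4 := by positivity
    nlinarith
  have h7 : (0 : ℝ) ≤ (p : ℝ) ^ 5 := by positivity
  refine ⟨P, inferInstance, signGraph ε, signGraph_triangleFree ε, by nlinarith, by nlinarith, ?_⟩
  refine surplus_le _ _ fun y hy => ?_
  have h8 := hε fun v => decide (y v = 1)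
  have h9 : ∀ v, boolSign (decide (y v = 1)) = y v := fun v => by
    rcases hy v with h | h <;> norm_num [boolSign, h]
  simp only [h9] at h8
  have h10 : 0 ≤ ∑ l, (∑ t, y (linePoint l t)) ^ 2 := Finset.sum_nonneg fun _ _ => sq_nonneg _
  rw [quadForm_signGraph]
  push_cast at h8
  nlinarith

end TriangleFree

/-! ### Projective norm graphs and `K₃,₃`-freeness -/

section NormGraph

variable {K : Type*} [Field K] {p : ℕ}

/-- The vertices of the projective norm graph: pairs of a field element and a norm. -/
abbrev NormVertex (K : Type*) [Field K] (p : ℕ) : Type _ :=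
  K × (powMonoidHom (p + 1) : Kˣ →* Kˣ).range

/-- The norm `a ↦ a ^ (p + 1)`, onto its image. -/
abbrev normHom (K : Type*) [Field K] (p : ℕ) : Kˣ →* (powMonoidHom (p + 1) : Kˣ →* Kˣ).range :=
  (powMonoidHom (p + 1) : Kˣ →* Kˣ).rangeRestrict

lemma coe_normHom (a : Kˣ) : (((normHom K p a : Kˣ)) : K) = (a : K) ^ (p + 1) := by
  simp [normHom]

/-- Adjacency in the projective norm graph, loops included. -/
def NormRel (u v : NormVertex K p) : Prop :=
  (u.1 + v.1) ^ (p + 1) = (((u.2 * v.2 : (powMonoidHom (p + 1) : Kˣ →* Kˣ).range) : Kˣ) : K)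

lemma NormRel.symm {u v : NormVertex K p} (h : NormRel u v) : NormRel v u := by
  unfold NormRel at *
  rw [add_comm, h, mul_comm]

lemma NormRel.add_ne_zero {u v : NormVertex K p} (h : NormRel u v) : u.1 + v.1 ≠ 0 := by
  intro h0
  rw [NormRel, h0, zero_pow (Nat.succ_ne_zero p)] at h
  exact Units.ne_zero _ h.symm

/-- Parametrises the neighbours of `u` by the unit `a = u.1 + v.1`; the norm then determines the
second coordinate. -/
lemma normRel_iff {u v : NormVertex K p} :
    NormRel u v ↔ ∃ a : Kˣ, ((a : K) - u.1, u.2⁻¹ * normHom K p a) = v := by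
  constructor
  · intro h
    refine ⟨Units.mk0 _ h.add_ne_zero, Prod.ext (by simp) ?_⟩
    have : normHom K p (Units.mk0 _ h.add_ne_zero) = u.2 * v.2 := by
      apply Subtype.ext
      apply Units.ext
      rw [coe_normHom]
      exact h
    simp only [this, inv_mul_cancel_left]
  · rintro ⟨a, rfl⟩
    rw [NormRel, mul_inv_cancel_left, coe_normHom]
    simp

/-- The projective norm graph. -/
def normGraph (K : Type*) [Field K] (p : ℕ) : SimpleGraph (NormVertex K p) where
  Adj u v := u ≠ v ∧ NormRel u v
  symm := ⟨fun _ _ h => ⟨h.1.symm, h.2.symm⟩⟩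
  loopless := ⟨fun _ h => h.1 rfl⟩

/-- On a line `δ A + Δ a = const`, the equation `a A = c` becomes a quadratic in `a` with leading
coefficient `Δ`, so it has at most two roots. -/
lemma false_of_three_solutions {a₁ a₂ a₃ A₁ A₂ A₃ δ Δ c : K} (hΔ : Δ ≠ 0)
    (h12 : a₁ ≠ a₂) (h13 : a₁ ≠ a₃) (h23 : a₂ ≠ a₃)
    (l2 : (A₂ - A₁) * δ = -(Δ * (a₂ - a₁))) (l3 : (A₃ - A₁) * δ = -(Δ * (a₃ - a₁)))
    (e1 : a₁ * A₁ = c) (e2 : a₂ * A₂ = c) (e3 : a₃ * A₃ = c) : False := by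
  have k2 : (a₂ - a₁) * (A₁ * δ - Δ * a₂) = 0 := by
    linear_combination δ * e2 - δ * e1 - a₂ * l2
  have k3 : (a₃ - a₁) * (A₁ * δ - Δ * a₃) = 0 := by
    linear_combination δ * e3 - δ * e1 - a₃ * l3
  have m2 : A₁ * δ - Δ * a₂ = 0 := by simpa [sub_eq_zero, h12.symm] using k2
  have m3 : A₁ * δ - Δ * a₃ = 0 := by simpa [sub_eq_zero, h13.symm] using k3
  have : Δ * (a₂ - a₃) = 0 := by linear_combination m3 - m2
  simp [sub_eq_zero, hΔ, h23] at this

/-- Dividing two norm equations by the third and inverting, `s = 1 / (x₂ + y)` satisfies `(s +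
e_i)^{p+1} = c_i` for `i = 0, 1`. As `(s + e)^p = s^p + e^p`, subtracting the two equations makes
`s` and `s^p` linearly related, leaving at most two values of `s`, although three common neighbours
give three. -/
lemma normGraph_free [Fact p.Prime] [CharP K p] :
    (completeBipartiteGraph (Fin 3) (Fin 3)).Free (normGraph K p) := by
  rintro ⟨f⟩
  set u : Fin 3 → NormVertex K p := fun i => f (.inl i) with hu
  set w : Fin 3 → NormVertex K p := fun j => f (.inr j) with hw
  have huinj : Function.Injective u := f.injective.comp Sum.inl_injective
  have hwinj : Function.Injective w := f.injective.comp Sum.inr_injective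
  have hrel : ∀ i j, NormRel (u i) (w j) := fun i j => by
    have : (normGraph K p).Adj (u i) (w j) := f.toHom.map_adj (by simp)
    exact this.2
  have hfst : ∀ a b c : NormVertex K p, NormRel a c → NormRel b c → a.1 = b.1 → a = b := by
    intro a b c h1 h2 h
    refine Prod.ext h ?_
    have h3 : ((a.2 * c.2 : _) : Kˣ) = ((b.2 * c.2 : _) : Kˣ) := by
      apply Units.ext
      rw [NormRel] at h1 h2
      rw [← h1, ← h2, h]
    exact mul_right_cancel (Subtype.ext h3)
  have hX : ∀ i j, i ≠ j → (u i).1 - (u j).1 ≠ 0 := fun i j hij h =>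
    hij (huinj (hfst _ _ (w 0) (hrel i 0) (hrel j 0) (sub_eq_zero.1 h)))
  have hY : ∀ i j, i ≠ j → (w i).1 ≠ (w j).1 := fun i j hij h =>
    hij (hwinj (hfst _ _ (u 0) (hrel 0 i).symm (hrel 0 j).symm h))
  have hne : ∀ i j, (u i).1 + (w j).1 ≠ 0 := fun i j => (hrel i j).add_ne_zero
  let s : Fin 3 → K := fun j => ((u 2).1 + (w j).1)⁻¹
  let e : Fin 3 → K := fun i => ((u i).1 - (u 2).1)⁻¹
  let c : Fin 3 → K := fun i =>
    (((u i).2 : Kˣ) : K) / ((((u 2).2 : Kˣ) : K) * ((u i).1 - (u 2).1) ^ (p + 1))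
  have hs : ∀ i j, i ≠ j → s i ≠ s j := fun i j hij h =>
    hY i j hij (add_left_cancel (inv_injective h))
  have key : ∀ i j, i ≠ 2 → (s j + e i) * (s j ^ p + e i ^ p) = c i := by
    intro i j hi
    have h1 : s j + e i = ((u i).1 + (w j).1) / (((u 2).1 + (w j).1) * ((u i).1 - (u 2).1)) := by
      have := hne 2 j
      have := hX i 2 hi
      simp only [s, e]
      field_simp
      ring
    have h2 : (s j + e i) * (s j ^ p + e i ^ p) = (s j + e i) ^ (p + 1) := by
      rw [← add_pow_char, pow_succ, mul_comm]
    have h3 : ((u i).1 + (w j).1) ^ (p + 1) = (((u i).2 : Kˣ) : K) * (((w j).2 : Kˣ) : K) := by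
      have := hrel i j
      rw [NormRel] at this
      rw [this]; simp
    have h4 : ((u 2).1 + (w j).1) ^ (p + 1) = (((u 2).2 : Kˣ) : K) * (((w j).2 : Kˣ) : K) := by
      have := hrel 2 j
      rw [NormRel] at this
      rw [this]; simp
    rw [h2, h1, div_pow, mul_pow, h3, h4]
    have n1 := Units.ne_zero ((u 2).2 : Kˣ)
    have n2 := Units.ne_zero ((w j).2 : Kˣ)
    have n3 := hX i 2 hi
    simp only [c]
    field_simp
  have he : e 0 - e 1 ≠ 0 := by
    intro h
    have := inv_injective (sub_eq_zero.1 h)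
    exact hX 0 1 (by decide) (by linear_combination this)
  have hE : e 0 ^ p - e 1 ^ p ≠ 0 := by
    rw [← sub_pow_char]
    exact pow_ne_zero _ he
  have hlin : ∀ j, ((s j ^ p + e 0 ^ p) - (s 0 ^ p + e 0 ^ p)) * (e 0 - e 1) =
      -((e 0 ^ p - e 1 ^ p) * ((s j + e 0) - (s 0 + e 0))) := by
    intro j
    linear_combination key 0 j (by decide) - key 0 0 (by decide) - key 1 j (by decide) +
      key 1 0 (by decide)
  exact false_of_three_solutions hE (fun h => hs 0 1 (by decide) (add_right_cancel h))
    (fun h => hs 0 2 (by decide) (add_right_cancel h))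
    (fun h => hs 1 2 (by decide) (add_right_cancel h)) (hlin 1) (hlin 2)
    (key 0 0 (by decide)) (key 0 1 (by decide)) (key 0 2 (by decide))

end NormGraph

lemma card_units_of_card_eq {K : Type*} [Field K] [Fintype K] [DecidableEq K] {p : ℕ}
    (hK : Fintype.card K = p ^ 2) : Fintype.card Kˣ = p ^ 2 - 1 := by
  rw [Fintype.card_units, hK]

lemma gcd_card_units {K : Type*} [Field K] [Fintype K] [DecidableEq K] {p : ℕ}
    (hK : Fintype.card K = p ^ 2) : (Nat.card Kˣ).gcd (p + 1) = p + 1 := by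
  rw [Nat.card_eq_fintype_card, card_units_of_card_eq hK, Nat.gcd_eq_right_iff_dvd]
  exact ⟨p - 1, by rw [← Nat.sq_sub_sq, one_pow]⟩

/-- Every fibre has the size of the kernel, which in a cyclic group of order `p² - 1` is `gcd (p² -
1, p + 1)`. -/
lemma card_normHom_fiber {K : Type*} [Field K] [Fintype K] [DecidableEq K] {p : ℕ}
    (hK : Fintype.card K = p ^ 2)
    (g : (powMonoidHom (p + 1) : Kˣ →* Kˣ).range) :
    Finset.card {b : Kˣ | normHom K p b = g} = p + 1 := by
  classical
  rw [MonoidHom.card_fiber_eq_of_mem_range (normHom K p)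
    (MonoidHom.rangeRestrict_surjective (powMonoidHom (p + 1) : Kˣ →* Kˣ) g)
    (⟨1, map_one _⟩ : (1 : (powMonoidHom (p + 1) : Kˣ →* Kˣ).range) ∈ Set.range (normHom K p))]
  have h := IsCyclic.card_powMonoidHom_ker Kˣ (p + 1)
  rw [gcd_card_units hK, Nat.card_eq_fintype_card] at h
  refine Eq.trans ?_ h
  rw [Fintype.card_subtype]
  congr 1
  ext b
  simp only [Finset.mem_filter, Finset.mem_univ, true_and, MonoidHom.mem_ker]
  rw [← Subtype.coe_inj]
  rfl

/-! ### The smallest eigenvalue of the norm graph -/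

section NormGraphSpectrum

variable {K : Type*} [Field K] {p : ℕ}

open Classical in
/-- The adjacency indicator of the projective norm graph, loops included. -/
noncomputable def normAdj (u v : NormVertex K p) : ℝ := if NormRel u v then 1 else 0

lemma normAdj_comm (u v : NormVertex K p) : normAdj u v = normAdj v u := by
  classical exact if_congr ⟨NormRel.symm, NormRel.symm⟩ rfl rfl

lemma normAdj_nonneg (u v : NormVertex K p) : 0 ≤ normAdj u v := by
  unfold normAdj; split_ifs <;> norm_num

lemma normAdj_le_one (u v : NormVertex K p) : normAdj u v ≤ 1 := by
  unfold normAdj; split_ifs <;> norm_num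

lemma adj_normGraph [DecidableEq K] (u v : NormVertex K p) :
    adj (normGraph K p) u v = normAdj u v - if u = v then normAdj v v else 0 := by
  by_cases h : u = v
  · subst h
    simp [adj_of_not_adj (SimpleGraph.irrefl _)]
  · simp only [h, if_false, sub_zero]
    classical
    exact if_congr (show (u ≠ v ∧ NormRel u v) ↔ NormRel u v by simp [h]) rfl rfl

variable [Fintype K] [DecidableEq K] [Fintype (powMonoidHom (p + 1) : Kˣ →* Kˣ).range]

lemma sum_normAdj_mul (u : NormVertex K p) (c : NormVertex K p → ℝ) :
    ∑ v, normAdj u v * c v = ∑ a : Kˣ, c ((a : K) - u.1, u.2⁻¹ * normHom K p a) := by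
  classical
  simp only [normAdj, ite_mul, one_mul, zero_mul]
  rw [← Finset.sum_filter]
  symm
  refine Finset.sum_nbij (fun a => ((a : K) - u.1, u.2⁻¹ * normHom K p a)) ?_ ?_ ?_ ?_
  · intro a _
    simp only [Finset.mem_filter, Finset.mem_univ, true_and]
    exact normRel_iff.2 ⟨a, rfl⟩
  · intro a _ b _ hab
    exact Units.ext (sub_left_injective (congrArg Prod.fst hab))
  · intro v hv
    simp only [Finset.coe_filter, Finset.mem_univ, true_and, Set.mem_ofPred_eq] at hv
    obtain ⟨a, ha⟩ := normRel_iff.1 hv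
    exact ⟨a, by simp, ha⟩
  · intro _ _
    rfl

lemma sum_normAdj (u : NormVertex K p) : ∑ v, normAdj u v = Fintype.card Kˣ := by
  have := sum_normAdj_mul u fun _ => 1
  simpa using this

lemma card_normRange (hK : Fintype.card K = p ^ 2) :
    Fintype.card (powMonoidHom (p + 1) : Kˣ →* Kˣ).range = p - 1 := by
  have h := IsCyclic.card_powMonoidHom_range (G := Kˣ) (p + 1)
  rw [gcd_card_units hK, Nat.card_eq_fintype_card, Nat.card_eq_fintype_card,
    card_units_of_card_eq hK] at h
  rw [h]
  refine Nat.div_eq_of_eq_mul_right (Nat.succ_pos p) ?_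
  rw [← Nat.sq_sub_sq, one_pow]

/-- The square of the adjacency matrix. When `u.1 ≠ v.1`, common neighbours correspond to elements
`b = 1 + (v.1 - u.1) / a` of norm `v.2 / u.2` other than `1`: a whole norm fibre, less one element
when `u.2 = v.2`. -/
lemma sum_normAdj_mul_normAdj (hp : p ≠ 0) (hK : Fintype.card K = p ^ 2)
    (u v : NormVertex K p) :
    ∑ w, normAdj u w * normAdj v w = (p + 1) - (p + 1) * (if u.1 = v.1 then 1 else 0)
      - (if u.2 = v.2 then 1 else 0) + p ^ 2 * (if u = v then 1 else 0) := by
  rw [sum_normAdj_mul]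
  have hrel : ∀ a : Kˣ, normAdj v ((a : K) - u.1, u.2⁻¹ * normHom K p a) =
      if (v.1 + ((a : K) - u.1)) ^ (p + 1) =
        (((v.2 * (u.2⁻¹ * normHom K p a) : (powMonoidHom (p + 1) : Kˣ →* Kˣ).range) : Kˣ) : K)
        then 1 else 0 := fun a => by
    rw [normAdj]
    classical exact if_congr Iff.rfl rfl rfl
  simp only [hrel]
  rw [Finset.sum_boole]
  by_cases h1 : u.1 = v.1
  · have e1 : ∀ a : Kˣ, (v.1 + ((a : K) - u.1)) ^ (p + 1) =
        (((v.2 * (u.2⁻¹ * normHom K p a) : (powMonoidHom (p + 1) : Kˣ →* Kˣ).range) : Kˣ) : K) ↔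
        u.2 = v.2 := by
      intro a
      rw [h1, add_sub_cancel, ← coe_normHom, Units.val_inj, Subtype.coe_inj, ← mul_assoc,
        right_eq_mul, mul_inv_eq_one, eq_comm]
    simp only [e1]
    by_cases h2 : u.2 = v.2
    · have h3 : u = v := Prod.ext h1 h2
      subst h3
      have hp1 : 1 ≤ p ^ 2 := Nat.one_le_pow _ _ (Nat.pos_of_ne_zero hp)
      simp only [if_true, Finset.filter_true, Finset.card_univ, card_units_of_card_eq hK]
      rw [Nat.cast_sub hp1]
      push_cast
      ring
    · have h3 : u ≠ v := fun h => h2 (congrArg Prod.snd h)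
      simp [h1, h2, h3]
  · have h3 : u ≠ v := fun h => h1 (congrArg Prod.fst h)
    have hD : v.1 - u.1 ≠ 0 := sub_ne_zero.2 (Ne.symm h1)
    have e1 : Finset.card {a : Kˣ | (v.1 + ((a : K) - u.1)) ^ (p + 1) =
        (((v.2 * (u.2⁻¹ * normHom K p a) : (powMonoidHom (p + 1) : Kˣ →* Kˣ).range) : Kˣ) : K)} =
        (({b : Kˣ | normHom K p b = v.2 * u.2⁻¹} : Finset Kˣ).erase 1).card := by
      have hmem : ∀ b : Kˣ, normHom K p b = v.2 * u.2⁻¹ ↔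
          (b : K) ^ (p + 1) = ((((v.2 * u.2⁻¹ :
            (powMonoidHom (p + 1) : Kˣ →* Kˣ).range) : Kˣ)) : K) := fun b => by
        rw [← coe_normHom, Units.val_inj, Subtype.coe_inj]
      symm
      refine Finset.card_bij (fun b hb => Units.mk0 ((v.1 - u.1) / ((b : K) - 1))
        (div_ne_zero hD (sub_ne_zero.2 fun h => (Finset.mem_erase.1 hb).1 (Units.ext h)))) ?_ ?_ ?_
      · intro b hb
        rw [Finset.mem_erase, Finset.mem_filter, hmem] at hb
        have hb1 : (b : K) - 1 ≠ 0 := sub_ne_zero.2 fun h => hb.1 (Units.ext h)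
        rw [Finset.mem_filter]
        refine ⟨Finset.mem_univ _, ?_⟩
        have e2 : v.1 + ((v.1 - u.1) / ((b : K) - 1) - u.1) =
            (b : K) * ((v.1 - u.1) / ((b : K) - 1)) := by
          field_simp
          ring
        rw [← mul_assoc]
        push_cast
        push_cast at hb
        rw [coe_normHom, Units.val_mk0, e2, mul_pow, hb.2.2]
      · intro b hb b' hb' h
        have hb1 : (b : K) - 1 ≠ 0 :=
          sub_ne_zero.2 fun h => (Finset.mem_erase.1 hb).1 (Units.ext h)
        have hb2 : (b' : K) - 1 ≠ 0 :=
          sub_ne_zero.2 fun h => (Finset.mem_erase.1 hb').1 (Units.ext h)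
        have h := congrArg Units.val h
        simp only [Units.val_mk0] at h
        rw [div_eq_div_iff hb1 hb2] at h
        exact Units.ext (sub_left_injective (mul_left_cancel₀ hD h).symm)
      · intro a ha
        rw [Finset.mem_filter] at ha
        have ha := ha.2
        rw [← mul_assoc] at ha
        push_cast at ha
        rw [coe_normHom] at ha
        have ha0 := a.ne_zero
        have hn : v.1 + ((a : K) - u.1) ≠ 0 := by
          intro h0
          rw [h0, zero_pow (Nat.succ_ne_zero p)] at ha
          exact mul_ne_zero (mul_ne_zero (Units.ne_zero _) (inv_ne_zero (Units.ne_zero _)))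
            (pow_ne_zero _ ha0) ha.symm
        have hbv : (v.1 + ((a : K) - u.1)) / a - 1 = (v.1 - u.1) / a := by
          field_simp
          ring
        refine ⟨Units.mk0 ((v.1 + ((a : K) - u.1)) / a) (div_ne_zero hn ha0), ?_, ?_⟩
        · rw [Finset.mem_erase, Finset.mem_filter, hmem]
          refine ⟨fun h => ?_, Finset.mem_univ _, ?_⟩
          · have h := congrArg Units.val h
            rw [Units.val_mk0, Units.val_one, ← sub_eq_zero, hbv] at h
            exact div_ne_zero hD ha0 h
          · rw [Units.val_mk0, div_pow, ha]
            push_cast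
            field_simp
        · apply Units.ext
          simp only [Units.val_mk0]
          rw [hbv]
          field_simp
    rw [e1]
    by_cases h2 : u.2 = v.2
    · rw [Finset.card_erase_of_mem (by simp [h2]), card_normHom_fiber hK]
      simp [h1, h2, h3]
    · rw [Finset.erase_eq_of_notMem, card_normHom_fiber hK]
      · simp [h1, h2, h3]
      · simp only [Finset.mem_filter, Finset.mem_univ, true_and, map_one]
        rw [eq_comm, mul_inv_eq_one]
        exact Ne.symm h2

end NormGraphSpectrum

lemma sum_sq_sum_symm {V : Type*} [Fintype V] (M : V → V → ℝ) (z : V → ℝ) (c : V → V → ℝ)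
    (hM : ∀ u v, M u v = M v u) (hc : ∀ u v, ∑ w, M u w * M v w = c u v) :
    ∑ w, (∑ u, M w u * z u) ^ 2 = ∑ u, ∑ v, c u v * (z u * z v) := by
  simp only [← hc, sq, Finset.sum_mul_sum]
  simp only [Finset.sum_mul]
  rw [Finset.sum_comm]
  refine Finset.sum_congr rfl fun u _ => ?_
  rw [Finset.sum_comm]
  refine Finset.sum_congr rfl fun v _ => Finset.sum_congr rfl fun w _ => ?_
  rw [hM w u, hM w v]
  ring

lemma sum_eq_fst_mul {α β : Type*} [Fintype α] [Fintype β] [DecidableEq α] (z : α × β → ℝ) :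
    ∑ u : α × β, ∑ v : α × β, (if u.1 = v.1 then 1 else 0) * (z u * z v) =
      ∑ a, (∑ b, z (a, b)) ^ 2 := by
  simp only [Fintype.sum_prod_type, ite_mul, one_mul, zero_mul, sq, Finset.sum_mul_sum]
  refine Finset.sum_congr rfl fun a _ => Finset.sum_congr rfl fun b _ => ?_
  rw [Finset.sum_comm]
  simp

lemma sum_eq_snd_mul {α β : Type*} [Fintype α] [Fintype β] [DecidableEq β] (z : α × β → ℝ) :
    ∑ u : α × β, ∑ v : α × β, (if u.2 = v.2 then 1 else 0) * (z u * z v) =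
      ∑ b, (∑ a, z (a, b)) ^ 2 := by
  simp only [Fintype.sum_prod_type, ite_mul, one_mul, zero_mul, sq, Finset.sum_mul_sum]
  rw [Finset.sum_comm]
  refine Finset.sum_congr rfl fun a _ => Finset.sum_congr rfl fun b _ => ?_
  simp

section NormGraphSurplus

variable {K : Type*} [Field K] {p : ℕ} [Fintype K] [DecidableEq K]
  [Fintype (powMonoidHom (p + 1) : Kˣ →* Kˣ).range]

/-- On vectors of mean zero, the projective norm graph has spectral norm at most `p`. -/
lemma sum_sq_normAdj_le (hp : p ≠ 0) (hK : Fintype.card K = p ^ 2) (z : NormVertex K p → ℝ)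
    (hz : ∑ v, z v = 0) :
    ∑ w, (∑ u, normAdj w u * z u) ^ 2 ≤ p ^ 2 * ∑ v, z v ^ 2 := by
  rw [sum_sq_sum_symm _ z _ normAdj_comm (sum_normAdj_mul_normAdj hp hK)]
  have e : ∑ u : NormVertex K p, ∑ v : NormVertex K p,
      (((p : ℝ) + 1) - (p + 1) * (if u.1 = v.1 then 1 else 0)
      - (if u.2 = v.2 then 1 else 0) + p ^ 2 * (if u = v then 1 else 0)) * (z u * z v) =
      (p + 1) * ((∑ u, z u) * ∑ v, z v) -
        (p + 1) * (∑ u : NormVertex K p, ∑ v : NormVertex K p,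
          (if u.1 = v.1 then 1 else 0) * (z u * z v)) -
        (∑ u : NormVertex K p, ∑ v : NormVertex K p,
          (if u.2 = v.2 then 1 else 0) * (z u * z v)) +
        p ^ 2 * ∑ u, ∑ v, (if u = v then 1 else 0) * (z u * z v) := by
    rw [Finset.sum_mul_sum]
    simp only [Finset.mul_sum, ← Finset.sum_sub_distrib, ← Finset.sum_add_distrib]
    exact Finset.sum_congr rfl fun u _ => Finset.sum_congr rfl fun v _ => by ring
  rw [e, sum_eq_fst_mul, sum_eq_snd_mul, hz]
  -- The all-ones term vanishes on mean zero, and the two block terms enter negatively as sums of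
  -- squares, leaving only `p²` times the identity.
  have h1 : 0 ≤ ∑ a, (∑ b, z (a, b)) ^ 2 := Finset.sum_nonneg fun _ _ => sq_nonneg _
  have h2 : 0 ≤ ∑ b, (∑ a, z (a, b)) ^ 2 := Finset.sum_nonneg fun _ _ => sq_nonneg _
  have h3 : ∑ u, ∑ v, (if u = v then 1 else 0) * (z u * z v) = ∑ v, z v ^ 2 := by
    simp [sq]
  rw [h3]
  have h4 : 0 ≤ ((p : ℝ) + 1) * ∑ a, (∑ b, z (a, b)) ^ 2 := by positivity
  linarith

/-- By regularity the constant part of `y` splits off and contributes nonnegatively. On the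
mean-zero part `z`, expanding `‖p z + A z‖² ≥ 0` with `‖A z‖ ≤ p ‖z‖` gives `⟨z, A z⟩ ≥ -p ‖z‖²`. -/
lemma neg_le_sum_normAdj (hp : p ≠ 0) (hK : Fintype.card K = p ^ 2) (y : NormVertex K p → ℝ) :
    -(p * ∑ v, y v ^ 2) ≤ ∑ u, ∑ v, normAdj u v * (y u * y v) := by
  have hp0 : (0 : ℝ) < p := by exact_mod_cast Nat.pos_of_ne_zero hp
  have hn0 : (0 : ℝ) < Fintype.card (NormVertex K p) := by exact_mod_cast Fintype.card_pos
  set n : ℝ := (Fintype.card (NormVertex K p) : ℝ) with hn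
  set d : ℝ := (Fintype.card Kˣ : ℝ) with hd
  set c : ℝ := (∑ v, y v) / n with hc
  set z : NormVertex K p → ℝ := fun v => y v - c with hzdef
  have hcn : n * c = ∑ v, y v := mul_div_cancel₀ _ hn0.ne'
  have hz : ∑ v, z v = 0 := by
    simp only [z, Finset.sum_sub_distrib, Finset.sum_const, Finset.card_univ, nsmul_eq_mul]
    linarith
  have hrow : ∀ u, ∑ v, normAdj u v * y v = d * c + ∑ v, normAdj u v * z v := by
    intro u
    rw [hd, ← sum_normAdj u, Finset.sum_mul, ← Finset.sum_add_distrib]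
    exact Finset.sum_congr rfl fun v _ => by simp only [z]; ring
  have hcol : ∑ u, ∑ v, normAdj u v * z v = 0 := by
    rw [Finset.sum_comm]
    have : ∀ v : NormVertex K p, ∑ u, normAdj u v * z v = d * z v := fun v => by
      rw [← Finset.sum_mul, hd, ← sum_normAdj v]
      congr 1
      exact Finset.sum_congr rfl fun u _ => normAdj_comm u v
    simp only [this, ← Finset.mul_sum, hz, mul_zero]
  have h1 : ∑ u, ∑ v, normAdj u v * (y u * y v) =
      d * c ^ 2 * n + ∑ u, z u * ∑ v, normAdj u v * z v := by
    have : ∀ u, ∑ v, normAdj u v * (y u * y v) =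
        d * c * y u + c * (∑ v, normAdj u v * z v) + z u * ∑ v, normAdj u v * z v := by
      intro u
      have e : ∑ v, normAdj u v * (y u * y v) = y u * ∑ v, normAdj u v * y v := by
        rw [Finset.mul_sum]
        exact Finset.sum_congr rfl fun v _ => by ring
      rw [e, hrow]
      simp only [z]
      ring
    simp only [this, Finset.sum_add_distrib]
    rw [← Finset.mul_sum, ← Finset.mul_sum, hcol, ← hcn]
    ring
  have h2 : ∑ v, z v ^ 2 ≤ ∑ v, y v ^ 2 := by
    have : ∀ v, z v ^ 2 = y v ^ 2 - 2 * c * y v + c ^ 2 := fun v => by simp only [z]; ring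
    simp only [this, Finset.sum_add_distrib, Finset.sum_sub_distrib, ← Finset.mul_sum,
      Finset.sum_const, Finset.card_univ, nsmul_eq_mul, ← hn, ← hcn]
    nlinarith [mul_nonneg hn0.le (sq_nonneg c)]
  have h3 : -(p * ∑ v, z v ^ 2) ≤ ∑ u, z u * ∑ v, normAdj u v * z v := by
    have e1 := sum_sq_normAdj_le hp hK z hz
    have e2 : 0 ≤ ∑ u, (p * z u + ∑ v, normAdj u v * z v) ^ 2 :=
      Finset.sum_nonneg fun _ _ => sq_nonneg _
    have e3 : ∑ u, (p * z u + ∑ v, normAdj u v * z v) ^ 2 = p ^ 2 * ∑ v, z v ^ 2 +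
        2 * p * (∑ u, z u * ∑ v, normAdj u v * z v) + ∑ u, (∑ v, normAdj u v * z v) ^ 2 := by
      simp only [Finset.mul_sum (s := Finset.univ) (a := (p : ℝ) ^ 2),
        Finset.mul_sum (s := Finset.univ) (a := 2 * (p : ℝ)), ← Finset.sum_add_distrib]
      exact Finset.sum_congr rfl fun u _ => by ring
    have e4 : 0 ≤ 2 * (p : ℝ) * (p * ∑ v, z v ^ 2 + ∑ u, z u * ∑ v, normAdj u v * z v) := by
      nlinarith
    have := nonneg_of_mul_nonneg_right e4 (by positivity)
    linarith
  have h4 : 0 ≤ d * c ^ 2 * n := by positivity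
  have h5 : p * ∑ v, z v ^ 2 ≤ p * ∑ v, y v ^ 2 := mul_le_mul_of_nonneg_left h2 hp0.le
  linarith

/-- The extra `1` in `p + 1` pays for deleting the loops. -/
lemma surplus_normGraph_le (hp : p ≠ 0) (hK : Fintype.card K = p ^ 2) :
    surplus (normGraph K p) ≤ (p + 1) * Fintype.card (NormVertex K p) / 4 := by
  refine surplus_le _ _ fun y hy => ?_
  have hy2 : ∀ v, y v ^ 2 = 1 := fun v => by rcases hy v with h | h <;> simp [h]
  have h1 := neg_le_sum_normAdj hp hK y
  simp only [hy2, Finset.sum_const, Finset.card_univ, nsmul_eq_mul, mul_one] at h1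
  have h2 : quadForm (normGraph K p) y =
      ∑ u, ∑ v, normAdj u v * (y u * y v) - ∑ v : NormVertex K p, normAdj v v := by
    simp only [quadForm, adj_normGraph, sub_mul, Finset.sum_sub_distrib, ite_mul, zero_mul,
      Finset.sum_ite_eq, Finset.mem_univ, if_true, ← sq, hy2, mul_one]
  have h3 : ∑ v : NormVertex K p, normAdj v v ≤ Fintype.card (NormVertex K p) := by
    refine (Finset.sum_le_sum fun v _ => normAdj_le_one v v).trans_eq ?_
    simp
  rw [h2]
  linarith

lemma edgeCount_normGraph :
    (Fintype.card (NormVertex K p) : ℝ) * (Fintype.card Kˣ - 1) ≤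
        2 * edgeCount (normGraph K p) ∧
      2 * (edgeCount (normGraph K p) : ℝ) ≤
        Fintype.card (NormVertex K p) * Fintype.card Kˣ := by
  have h : 2 * (edgeCount (normGraph K p) : ℝ) =
      Fintype.card (NormVertex K p) * Fintype.card Kˣ - ∑ v : NormVertex K p, normAdj v v := by
    rw [two_mul_edgeCount]
    simp only [adj_normGraph, Finset.sum_sub_distrib, Finset.sum_ite_eq, Finset.mem_univ, if_true,
      sum_normAdj, Finset.sum_const, Finset.card_univ, nsmul_eq_mul]
  have h3 : ∑ v : NormVertex K p, normAdj v v ≤ Fintype.card (NormVertex K p) := by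
    refine (Finset.sum_le_sum fun v _ => normAdj_le_one v v).trans_eq ?_
    simp
  have h4 : 0 ≤ ∑ v : NormVertex K p, normAdj v v :=
    Finset.sum_nonneg fun v _ => normAdj_nonneg v v
  constructor <;> linarith

end NormGraphSurplus

/-- `K₃,₃`-free graphs of small surplus. -/
lemma exists_completeBipartiteFree_of_prime (p : ℕ) (hp : p.Prime) :
    ∃ (V : Type) (_ : Fintype V) (G : SimpleGraph V),
      (completeBipartiteGraph (Fin 3) (Fin 3)).Free G ∧
      1 / 8 * (p : ℝ) ^ 5 ≤ edgeCount G ∧ (edgeCount G : ℝ) ≤ (p : ℝ) ^ 5 ∧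
      surplus G ≤ 1 * (p : ℝ) ^ 4 := by
  classical
  have : Fact p.Prime := ⟨hp⟩
  let K := GaloisField p 2
  let _ : Fintype K := Fintype.ofFinite K
  have hK : Fintype.card K = p ^ 2 := by
    rw [← Nat.card_eq_fintype_card, GaloisField.card p 2 two_ne_zero]
  have hV : (Fintype.card (NormVertex K p) : ℝ) = p ^ 2 * (p - 1) := by
    rw [Fintype.card_prod, card_normRange hK, hK, Nat.cast_mul, Nat.cast_sub hp.one_le]
    push_cast
    ring
  have hU : (Fintype.card Kˣ : ℝ) = p ^ 2 - 1 := by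
    rw [card_units_of_card_eq hK, Nat.cast_sub (Nat.one_le_pow _ _ hp.pos)]
    push_cast
    ring
  obtain ⟨h1, h2⟩ := edgeCount_normGraph (K := K) (p := p)
  have h3 := surplus_normGraph_le hp.ne_zero hK
  rw [hV, hU] at h1 h2
  rw [hV] at h3
  have hp2 : (2 : ℝ) ≤ p := by exact_mod_cast hp.two_le
  have hp4 : (4 : ℝ) ≤ (p : ℝ) ^ 2 := by nlinarith
  have h0 : (0 : ℝ) ≤ (p : ℝ) ^ 2 := by positivity
  refine ⟨NormVertex K p, inferInstance, normGraph K p, normGraph_free, ?_, ?_, ?_⟩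
  -- Already for `p ≥ 2` one has `p - 1 ≥ p / 2` and `p² - 2 ≥ p² / 2`, so no threshold on the prime
  -- is needed.
  · have e1 : (p : ℝ) / 2 * ((p : ℝ) ^ 2 / 2) ≤ (p - 1) * (p ^ 2 - 1 - 1) := by
      apply mul_le_mul <;> nlinarith
    have e2 := mul_le_mul_of_nonneg_left e1 h0
    linarith
  · have e1 : ((p : ℝ) - 1) * (p ^ 2 - 1) ≤ p * p ^ 2 := by
      apply mul_le_mul <;> nlinarith
    have e2 := mul_le_mul_of_nonneg_left e1 h0
    have e3 : (0 : ℝ) ≤ (p : ℝ) ^ 5 := by positivity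
    linarith
  · refine h3.trans ?_
    nlinarith

end MaxCutSurplus

theorem mainTheorem4 {W : Type*} [Finite W] (H : SimpleGraph W) (v : W)
    (hnontrivial : Nontrivial ({v}ᶜ : Set W))
    (hbip : (H.induce ({v}ᶜ : Set W)).IsBipartite)
    (hex : (fun n : ℕ => (SimpleGraph.extremalNumber n (H.induce ({v}ᶜ : Set W)) : ℝ))
      =O[atTop] fun n : ℕ => (n : ℝ) ^ (3 / 2 : ℝ)) :
    (∃ c : ℝ, 0 < c ∧ ∀ m : ℕ,
      ((c * (m : ℝ) ^ (4 / 5 : ℝ) : ℝ) : EReal) ≤ MaxCutSurplus.minSurplus m H) ∧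
    ((SimpleGraph.IsContained (⊤ : SimpleGraph (Fin 3)) H ∨
        SimpleGraph.IsContained (completeBipartiteGraph (Fin 3) (Fin 3)) H) →
      ∃ C : ℝ, 0 < C ∧ ∀ m : ℕ,
        MaxCutSurplus.minSurplus m H ≤ ((C * (m : ℝ) ^ (4 / 5 : ℝ) : ℝ) : EReal)) := by
  refine ⟨MaxCutSurplus.exists_le_minSurplus H v hex, ?_⟩
  rintro (h | h)
  · exact MaxCutSurplus.exists_minSurplus_le_of_contained h
      (MaxCutSurplus.exists_free_surplus_le SimpleGraph.connected_top (by simp) (by norm_num)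
        zero_le_one 16 MaxCutSurplus.exists_triangleFree_of_prime)
  · exact MaxCutSurplus.exists_minSurplus_le_of_contained h
      (MaxCutSurplus.exists_free_surplus_le MaxCutSurplus.connected_completeBipartiteGraph
        (by simp) (by norm_num) zero_le_one 0
        fun p hp _ => MaxCutSurplus.exists_completeBipartiteFree_of_prime p hp)
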